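/- Let $p,q\ge 1$ be integers and let $(\overline M,\overline g,J)$ be a locally metallic Riemannian manifold: $\overline g$ is a Riemannian metric with Levi-Civita connection $\overline\nabla$, and $J$ is a smooth $(1,1)$-tensor field with $J^2=pJ+qI$, $\overline g(JX,Y)=\overline g(X,JY)$ and $\overline\nabla J=0$ (for $p=q=1$: locally Golden). Let $(M_{1\perp},g_1)$ and $(M_{2\perp},g_2)$ be (nonempty) Riemannian manifolds of positive dimension, let $f:M_{1\perp}\to(0,\infty)$ be smooth, and let $M=M_{1\perp}\times_f M_{2\perp}$, i.e. the product $M_{1\perp}\times M_{2\perp}$ with the metric $\pi_1^*g_1+(f\circ\pi_1)^2\pi_2^*g_2$, be isometrically immersed in $\overline M$. For a vector field $X$ on $M$ and a normal field $V$ along $M$ let $NX=(JX)^\perp$ and $tV=(JV)^\top$ be the normal component of $JX$ and the tangential component of $JV$ with respect to $M$, let $h(X,Y)=(\overline\nabla_XY)^\perp$ be the second fundamental form and $\nabla^\perp_XV=(\overline\nabla_XV)^\perp$ the normal connection of $M$. Assume that both factors are anti-invariant, i.e. $J$ maps the vectors of $TM$ tangent to $M_{1\perp}$ and those tangent to $M_{2\perp}$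 into the normal bundle $T^\perp M$. Then $f$ is constant on each connected component of $M_{1\perp}$ if and only if $$t\nabla^\perp_Z NX = p\, t\,h(X,Z)$$ for all smooth vector fields $X$ on $M_{1\perp}$ and $Z$ on $M_{2\perp}$ (identified with their horizontal and vertical lifts to $M$). -/

import Mathlib

open Set Manifold Bundle
open scoped Manifold ContDiff Topology

noncomputable section

namespace MetallicWarped

/-! ### Levi-Civita connection of a Riemannian manifold, in coordinates -/

section LeviCivita

variable {E : Type*} [NormedAddCommGroup E] [NormedSpace ℝ E]
  {H : Type*} [TopologicalSpace H] {I : ModelWithCorners ℝ E H}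
  {M : Type*} [TopologicalSpace M] [ChartedSpace H M] [IsManifold I ∞ M]

/-- The metric read in the chart around `y₀`: the bilinear form `(a, b) ↦ ∑ g_{ij}(u) aⁱ bʲ`
on the model space, at the point of coordinates `u`. -/
def coordMetric (g : ContMDiffRiemannianMetric I ∞ E (fun y : M ↦ TangentSpace I y))
    (y₀ : M) (u : E) : E →L[ℝ] E →L[ℝ] ℝ :=
  let A : E →L[ℝ] TangentSpace I ((extChartAt I y₀).symm u) :=
    mfderiv 𝓘(ℝ, E) I (extChartAt I y₀).symm u
  (ContinuousLinearMap.precomp ℝ A) ∘L (g.inner ((extChartAt I y₀).symm u)) ∘L A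

/-- The Christoffel symbols (of the second kind) in the chart around `y₀`, at the point of
coordinates `u`: `Γ(a, b)` is the vector with
`2 g(Γ(a, b), c) = (∂_a g)(b, c) + (∂_b g)(a, c) - (∂_c g)(a, b)` for all `c`. -/
def christoffel (g : ContMDiffRiemannianMetric I ∞ E (fun y : M ↦ TangentSpace I y))
    (y₀ : M) (u a b : E) : E :=
  let dG := fderiv ℝ (coordMetric g y₀) u
  (2⁻¹ : ℝ) • (coordMetric g y₀ u).inverse (dG a b + dG b a - (dG.flip a).flip b)

variable {E' : Type*} [NormedAddCommGroup E'] [NormedSpace ℝ E']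
  {H' : Type*} [TopologicalSpace H'] (I' : ModelWithCorners ℝ E' H')
  {N : Type*} [TopologicalSpace N] [ChartedSpace H' N]

/-- The Levi-Civita derivative `∇̄_v V` at `x` of a vector field `V` along a map `φ : N → M`, in
the direction `v ∈ T_x N`. In the chart of `M` around `φ x` it is
`(∇̄_v V)ᵏ = v(Vᵏ) + Γᵏ_{ij} (dφ v)ⁱ Vʲ`. -/
def covDerivAlong (g : ContMDiffRiemannianMetric I ∞ E (fun y : M ↦ TangentSpace I y))
    (φ : N → M) (V : (x : N) → TangentSpace I (φ x)) (x : N) (v : TangentSpace I' x) :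
    TangentSpace I (φ x) :=
  let c : (y : M) → TangentSpace I y → E := fun y w ↦ mfderiv I 𝓘(ℝ, E) (extChartAt I (φ x)) y w
  let Vc : N → E := fun x' ↦ c (φ x') (V x')
  let dVc : E := mfderiv I' 𝓘(ℝ, E) Vc x v
  (mfderiv I 𝓘(ℝ, E) (extChartAt I (φ x)) (φ x)).inverse
    (dVc + christoffel g (φ x) (extChartAt I (φ x) (φ x))
      (c (φ x) (mfderiv I' I φ x v)) (Vc x))

/-- The Levi-Civita connection `∇̄_v Y` of `(M, g)`. -/
def leviCivita (g : ContMDiffRiemannianMetric I ∞ E (fun y : M ↦ TangentSpace I y))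
    (Y : (y : M) → TangentSpace I y) (y : M) (v : TangentSpace I y) : TangentSpace I y :=
  covDerivAlong (I := I) I g (fun y ↦ y) Y y v

end LeviCivita

/-! ### Metallic Riemannian manifolds -/

section Metallic

variable {E : Type*} [NormedAddCommGroup E] [NormedSpace ℝ E]
  {H : Type*} [TopologicalSpace H] {I : ModelWithCorners ℝ E H}
  {M : Type*} [TopologicalSpace M] [ChartedSpace H M] [IsManifold I ∞ M]

/-- A vector field of class `C^∞`. -/
def IsSmoothVectorField (I : ModelWithCorners ℝ E H) {M : Type*} [TopologicalSpace M]
    [ChartedSpace H M] [IsManifold I ∞ M] (X : (y : M) → TangentSpace I y) : Prop :=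
  ContMDiff I I.tangent ∞ (fun y ↦ (⟨y, X y⟩ : TangentBundle I M))

/-- `(M, g, J)` is a metallic Riemannian manifold: `J` is a smooth `(1,1)`-tensor field with
`J² = p J + q I`, and `g` is `J`-compatible. -/
structure IsMetallicRiemannian (p q : ℕ)
    (g : ContMDiffRiemannianMetric I ∞ E (fun y : M ↦ TangentSpace I y))
    (J : (y : M) → TangentSpace I y →L[ℝ] TangentSpace I y) : Prop where
  smooth : ContMDiff I (I.prod 𝓘(ℝ, E →L[ℝ] E)) ∞
    (fun y ↦ TotalSpace.mk' (E →L[ℝ] E)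
      (E := fun y : M ↦ TangentSpace I y →L[ℝ] TangentSpace I y) y (J y))
  sq : ∀ (y : M) (v : TangentSpace I y), J y (J y v) = (p : ℝ) • J y v + (q : ℝ) • v
  compatible : ∀ (y : M) (v w : TangentSpace I y), g.inner y (J y v) w = g.inner y v (J y w)

/-- `(M, g, J)` is a locally metallic Riemannian manifold: it is metallic and `∇̄J = 0`, i.e.
`∇̄_v (J Y) = J (∇̄_v Y)` for every smooth vector field `Y` and every tangent vector `v`. -/
structure IsLocallyMetallicRiemannian (p q : ℕ)
    (g : ContMDiffRiemannianMetric I ∞ E (fun y : M ↦ TangentSpace I y))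
    (J : (y : M) → TangentSpace I y →L[ℝ] TangentSpace I y) : Prop
    extends IsMetallicRiemannian p q g J where
  parallel : ∀ Y : (y : M) → TangentSpace I y, IsSmoothVectorField I Y →
    ∀ (y : M) (v : TangentSpace I y),
      leviCivita g (fun y ↦ J y (Y y)) y v = J y (leviCivita g Y y v)

end Metallic

/-! ### Submanifolds -/

section Submanifold

variable {E : Type*} [NormedAddCommGroup E] [NormedSpace ℝ E] [FiniteDimensional ℝ E]
  {H : Type*} [TopologicalSpace H] {I : ModelWithCorners ℝ E H}
  {M : Type*} [TopologicalSpace M] [ChartedSpace H M] [IsManifold I ∞ M]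
  {E' : Type*} [NormedAddCommGroup E'] [NormedSpace ℝ E']
  {H' : Type*} [TopologicalSpace H'] (I' : ModelWithCorners ℝ E' H')
  {N : Type*} [TopologicalSpace N] [ChartedSpace H' N]

/-- The inner product `g_y` as a bilinear form. -/
def metricForm (g : ContMDiffRiemannianMetric I ∞ E (fun y : M ↦ TangentSpace I y)) (y : M) :
    LinearMap.BilinForm ℝ (TangentSpace I y) :=
  LinearMap.mk₂ ℝ (fun v w ↦ g.inner y v w) (by simp) (by simp) (by simp) (by simp)

/-- The tangent space `φ_* T_x N ⊆ T_{φ x} M` of the immersed submanifold `φ : N → M`. -/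
def tangentAt (φ : N → M) (x : N) : Submodule ℝ (TangentSpace I (φ x)) :=
  LinearMap.range (mfderiv I' I φ x).toLinearMap

/-- The normal space `T_x^⊥ N ⊆ T_{φ x} M` of the immersed submanifold `φ : N → M`. -/
def normalAt (g : ContMDiffRiemannianMetric I ∞ E (fun y : M ↦ TangentSpace I y))
    (φ : N → M) (x : N) : Submodule ℝ (TangentSpace I (φ x)) :=
  (metricForm g (φ x)).orthogonal (tangentAt (I := I) I' φ x)

theorem isCompl_tangentAt_normalAt
    (g : ContMDiffRiemannianMetric I ∞ E (fun y : M ↦ TangentSpace I y)) (φ : N → M) (x : N) :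
    IsCompl (tangentAt (I := I) I' φ x) (normalAt I' g φ x) := by
  have : FiniteDimensional ℝ (TangentSpace I (φ x)) := inferInstanceAs (FiniteDimensional ℝ E)
  have hs : (metricForm g (φ x)).IsSymm := ⟨fun v w ↦ g.symm (φ x) v w⟩
  refine LinearMap.BilinForm.isCompl_orthogonal_of_restrict_nondegenerate hs.isRefl ?_
  have h0 : ∀ v : tangentAt (I := I) I' φ x,
      (∀ w, ((metricForm g (φ x)).restrict (tangentAt (I := I) I' φ x)) v w = 0) → v = 0 := by
    intro v hv
    by_contra hne
    have h1 := g.pos (φ x) v.1 (fun h ↦ hne (Subtype.ext h))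
    exact h1.ne' (hv v)
  refine ⟨h0, fun v hv ↦ h0 v fun w ↦ ?_⟩
  have h1 := hv w
  rw [LinearMap.BilinForm.restrict_apply] at h1 ⊢
  exact (hs.eq _ _).trans h1

/-- The tangential component `vᵀ` of `v ∈ T_{φ x} M`. -/
def tangentPart (g : ContMDiffRiemannianMetric I ∞ E (fun y : M ↦ TangentSpace I y))
    (φ : N → M) (x : N) : TangentSpace I (φ x) →ₗ[ℝ] TangentSpace I (φ x) :=
  Submodule.projection _ _ (isCompl_tangentAt_normalAt I' g φ x)

/-- The normal component `v^⊥` of `v ∈ T_{φ x} M`. -/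
def normalPart (g : ContMDiffRiemannianMetric I ∞ E (fun y : M ↦ TangentSpace I y))
    (φ : N → M) (x : N) : TangentSpace I (φ x) →ₗ[ℝ] TangentSpace I (φ x) :=
  Submodule.projection _ _ (isCompl_tangentAt_normalAt I' g φ x).symm

/-- The normal field `N X = (J X)^⊥` along `φ`, for a vector field `X` on the submanifold. -/
def opN (g : ContMDiffRiemannianMetric I ∞ E (fun y : M ↦ TangentSpace I y))
    (J : (y : M) → TangentSpace I y →L[ℝ] TangentSpace I y)
    (φ : N → M) (X : (x : N) → TangentSpace I' x) (x : N) : TangentSpace I (φ x) :=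
  normalPart I' g φ x (J (φ x) (mfderiv I' I φ x (X x)))

/-- `t V = (J V)ᵀ`, for `V` normal to the submanifold at `x`. -/
def opt (g : ContMDiffRiemannianMetric I ∞ E (fun y : M ↦ TangentSpace I y))
    (J : (y : M) → TangentSpace I y →L[ℝ] TangentSpace I y)
    (φ : N → M) (x : N) (V : TangentSpace I (φ x)) : TangentSpace I (φ x) :=
  tangentPart I' g φ x (J (φ x) V)

/-- The normal connection `∇^⊥_v V = (∇̄_v V)^⊥`, for a normal field `V` along `φ`. -/
def normalConnection (g : ContMDiffRiemannianMetric I ∞ E (fun y : M ↦ TangentSpace I y))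
    (φ : N → M) (V : (x : N) → TangentSpace I (φ x)) (x : N) (v : TangentSpace I' x) :
    TangentSpace I (φ x) :=
  normalPart I' g φ x (covDerivAlong I' g φ V x v)

/-- The second fundamental form `h(X, Y) = (∇̄_X Y)^⊥`, for vector fields `X`, `Y` on the
submanifold. -/
def secondFundamentalForm (g : ContMDiffRiemannianMetric I ∞ E (fun y : M ↦ TangentSpace I y))
    (φ : N → M) (X Y : (x : N) → TangentSpace I' x) (x : N) : TangentSpace I (φ x) :=
  normalPart I' g φ x (covDerivAlong I' g φ (fun x' ↦ mfderiv I' I φ x' (Y x')) x (X x))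

end Submanifold

/-! ### Warped products -/

section Warped

variable {E₁ : Type*} [NormedAddCommGroup E₁] [NormedSpace ℝ E₁]
  {H₁ : Type*} [TopologicalSpace H₁] {I₁ : ModelWithCorners ℝ E₁ H₁}
  {M₁ : Type*} [TopologicalSpace M₁] [ChartedSpace H₁ M₁] [IsManifold I₁ ∞ M₁]
  {E₂ : Type*} [NormedAddCommGroup E₂] [NormedSpace ℝ E₂]
  {H₂ : Type*} [TopologicalSpace H₂] {I₂ : ModelWithCorners ℝ E₂ H₂}
  {M₂ : Type*} [TopologicalSpace M₂] [ChartedSpace H₂ M₂] [IsManifold I₂ ∞ M₂]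

/-- The horizontal lift to `M₁ × M₂` of a vector field on `M₁`. -/
def horizontalLift (I₁ : ModelWithCorners ℝ E₁ H₁) (I₂ : ModelWithCorners ℝ E₂ H₂)
    {M₁ : Type*} [TopologicalSpace M₁] [ChartedSpace H₁ M₁]
    {M₂ : Type*} [TopologicalSpace M₂] [ChartedSpace H₂ M₂]
    (X : (x : M₁) → TangentSpace I₁ x) (z : M₁ × M₂) : TangentSpace (I₁.prod I₂) z :=
  mfderiv I₁ (I₁.prod I₂) (fun x ↦ (x, z.2)) z.1 (X z.1)

/-- The vertical lift to `M₁ × M₂` of a vector field on `M₂`. -/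
def verticalLift (I₁ : ModelWithCorners ℝ E₁ H₁) (I₂ : ModelWithCorners ℝ E₂ H₂)
    {M₁ : Type*} [TopologicalSpace M₁] [ChartedSpace H₁ M₁]
    {M₂ : Type*} [TopologicalSpace M₂] [ChartedSpace H₂ M₂]
    (Z : (y : M₂) → TangentSpace I₂ y) (z : M₁ × M₂) : TangentSpace (I₁.prod I₂) z :=
  mfderiv I₂ (I₁.prod I₂) (fun y ↦ (z.1, y)) z.2 (Z z.2)

/-- The warped product metric `π₁^* g₁ + (f ∘ π₁)² π₂^* g₂` on `M₁ × M₂`. -/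
def warpedMetric (g₁ : ContMDiffRiemannianMetric I₁ ∞ E₁ (fun x : M₁ ↦ TangentSpace I₁ x))
    (g₂ : ContMDiffRiemannianMetric I₂ ∞ E₂ (fun y : M₂ ↦ TangentSpace I₂ y))
    (f : M₁ → ℝ) (z : M₁ × M₂) (v w : TangentSpace (I₁.prod I₂) z) : ℝ :=
  g₁.inner z.1 (mfderiv (I₁.prod I₂) I₁ Prod.fst z v) (mfderiv (I₁.prod I₂) I₁ Prod.fst z w) +
  f z.1 ^ 2 *
    g₂.inner z.2 (mfderiv (I₁.prod I₂) I₂ Prod.snd z v) (mfderiv (I₁.prod I₂) I₂ Prod.snd z w)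

variable {E : Type*} [NormedAddCommGroup E] [NormedSpace ℝ E] [FiniteDimensional ℝ E]
  {H : Type*} [TopologicalSpace H] {I : ModelWithCorners ℝ E H}
  {M : Type*} [TopologicalSpace M] [ChartedSpace H M] [IsManifold I ∞ M]

/-- `i : M₁ ×_f M₂ → M` is an isometrically immersed warped product submanifold of `(M, g)`, with
smooth positive warping function `f` (that `i` is an immersion follows from the isometry
condition, as the warped product metric is positive definite). -/
structure IsWarpedProductSubmanifold
    (g₁ : ContMDiffRiemannianMetric I₁ ∞ E₁ (fun x : M₁ ↦ TangentSpace I₁ x))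
    (g₂ : ContMDiffRiemannianMetric I₂ ∞ E₂ (fun y : M₂ ↦ TangentSpace I₂ y))
    (f : M₁ → ℝ)
    (g : ContMDiffRiemannianMetric I ∞ E (fun y : M ↦ TangentSpace I y))
    (i : M₁ × M₂ → M) : Prop where
  warping_smooth : ContMDiff I₁ 𝓘(ℝ, ℝ) ∞ f
  warping_pos : ∀ x, 0 < f x
  smooth : ContMDiff (I₁.prod I₂) I ∞ i
  isometric : ∀ (z : M₁ × M₂) (v w : TangentSpace (I₁.prod I₂) z),
    g.inner (i z) (mfderiv (I₁.prod I₂) I i z v) (mfderiv (I₁.prod I₂) I i z w) =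
      warpedMetric g₁ g₂ f z v w

/-- The factor `M₁` is anti-invariant: `J` maps the vectors tangent to `M₁` into the normal
space of the submanifold `M₁ × M₂`, i.e. `J X = N X` for `X` tangent to `M₁`. -/
def FstAntiInvariant (I₁ : ModelWithCorners ℝ E₁ H₁) (I₂ : ModelWithCorners ℝ E₂ H₂)
    {M₁ : Type*} [TopologicalSpace M₁] [ChartedSpace H₁ M₁]
    {M₂ : Type*} [TopologicalSpace M₂] [ChartedSpace H₂ M₂]
    (g : ContMDiffRiemannianMetric I ∞ E (fun y : M ↦ TangentSpace I y))
    (J : (y : M) → TangentSpace I y →L[ℝ] TangentSpace I y) (i : M₁ × M₂ → M) : Prop :=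
  ∀ (z : M₁ × M₂) (v : TangentSpace (I₁.prod I₂) z),
    mfderiv (I₁.prod I₂) I₂ Prod.snd z v = 0 →
      J (i z) (mfderiv (I₁.prod I₂) I i z v) ∈ normalAt (I₁.prod I₂) g i z

/-- The factor `M₂` is anti-invariant: `J` maps the vectors tangent to `M₂` into the normal
space of the submanifold `M₁ × M₂`, i.e. `J Z = N Z` for `Z` tangent to `M₂`. -/
def SndAntiInvariant (I₁ : ModelWithCorners ℝ E₁ H₁) (I₂ : ModelWithCorners ℝ E₂ H₂)
    {M₁ : Type*} [TopologicalSpace M₁] [ChartedSpace H₁ M₁]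
    {M₂ : Type*} [TopologicalSpace M₂] [ChartedSpace H₂ M₂]
    (g : ContMDiffRiemannianMetric I ∞ E (fun y : M ↦ TangentSpace I y))
    (J : (y : M) → TangentSpace I y →L[ℝ] TangentSpace I y) (i : M₁ × M₂ → M) : Prop :=
  ∀ (z : M₁ × M₂) (v : TangentSpace (I₁.prod I₂) z),
    mfderiv (I₁.prod I₂) I₁ Prod.fst z v = 0 →
      J (i z) (mfderiv (I₁.prod I₂) I i z v) ∈ normalAt (I₁.prod I₂) g i z

end Warped

end MetallicWarped

end

/-! Write `D` for `∇̄_Z X` along the immersion `i`, where `X` is horizontal and `Z` is vertical.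
Both factors are anti-invariant, so `J` sends every tangent vector of the product to a normal one;
in particular `NX = JX`. Since `∇̄J = 0`, it follows that `∇̄_Z NX = J D`.

For any ambient `v`, the tangential part of `J (vᵀ)` vanishes, so `t (v^⊥) = (J v)ᵀ`. With `v = J D`
and `J² = pJ + qI`, the left side of the identity is `(J² D)ᵀ = p (J D)ᵀ + q Dᵀ`. On the right,
lifts from different factors commute, so `∇̄_X Z = D` and `p t h(X, Z) = p (J D)ᵀ`. As `q ≠ 0`, the
identity holds exactly when `Dᵀ = 0` (`opt_normalPart_apply_eq_iff`).

Koszul's formula for the warped metric gives `Dᵀ = (X f / f) Z`, in the weak form `g(D, i_* γ) = f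
(X f) g₂(Z, γ₂)` of `IsWarpedProductSubmanifold.inner_covDerivAlong`. Choosing `Z` nonzero at a
point shows that the identity for all `X`, `Z` means `df = 0`, which is constancy on connected
components.

The connection is given by Christoffel symbols in the chart centred at the point considered, so the
geometric inputs are proved there: `covDerivAlong_lift_comm` (symmetry),
`IsLocallyMetallicRiemannian.covDerivAlong_apply` (parallelism along a map) and `koszul_warped`. -/

namespace MetallicWarped

/-! ### Vector fields, the metric and `J` read in a chart -/

section Charts

variable {E : Type*} [NormedAddCommGroup E] [NormedSpace ℝ E]
  {M : Type*} [TopologicalSpace M] [ChartedSpace E M] [IsManifold 𝓘(ℝ, E) ∞ M]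

theorem mfderiv_chart_symm_apply {y₀ y : M} (hy : y ∈ (extChartAt 𝓘(ℝ, E) y₀).source)
    (v : TangentSpace 𝓘(ℝ, E) y) :
    mfderiv 𝓘(ℝ, E) 𝓘(ℝ, E) (extChartAt 𝓘(ℝ, E) y₀).symm (extChartAt 𝓘(ℝ, E) y₀ y)
      (mfderiv 𝓘(ℝ, E) 𝓘(ℝ, E) (extChartAt 𝓘(ℝ, E) y₀) y v) = v := by
  have : IsManifold 𝓘(ℝ, E) 1 M := .of_le (n := ∞) (by norm_cast)
  have h := mfderivWithin_extChartAt_symm_comp_mfderiv_extChartAt' (I := 𝓘(ℝ, E)) hy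
  rw [modelWithCornersSelf_coe, range_id, mfderivWithin_univ] at h
  exact congr($h v)

theorem mfderiv_chart_apply_symm {y₀ : M} {u : E} (hu : u ∈ (extChartAt 𝓘(ℝ, E) y₀).target)
    (a : E) :
    mfderiv 𝓘(ℝ, E) 𝓘(ℝ, E) (extChartAt 𝓘(ℝ, E) y₀) ((extChartAt 𝓘(ℝ, E) y₀).symm u)
      (mfderiv 𝓘(ℝ, E) 𝓘(ℝ, E) (extChartAt 𝓘(ℝ, E) y₀).symm u a) = a := by
  have : IsManifold 𝓘(ℝ, E) 1 M := .of_le (n := ∞) (by norm_cast)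
  have h := mfderiv_extChartAt_comp_mfderivWithin_extChartAt_symm (I := 𝓘(ℝ, E)) hu
  rw [modelWithCornersSelf_coe, range_id, mfderivWithin_univ] at h
  exact congr($h a)

theorem mfderiv_chart_apply_symm' {y₀ y : M} (hy : y ∈ (extChartAt 𝓘(ℝ, E) y₀).source) (a : E) :
    mfderiv 𝓘(ℝ, E) 𝓘(ℝ, E) (extChartAt 𝓘(ℝ, E) y₀) y
      (mfderiv 𝓘(ℝ, E) 𝓘(ℝ, E) (extChartAt 𝓘(ℝ, E) y₀).symm (extChartAt 𝓘(ℝ, E) y₀ y) a) = a := by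
  have : IsManifold 𝓘(ℝ, E) 1 M := .of_le (n := ∞) (by norm_cast)
  have h := mfderiv_extChartAt_comp_mfderivWithin_extChartAt_symm' (I := 𝓘(ℝ, E)) hy
  rw [modelWithCornersSelf_coe, range_id, mfderivWithin_univ] at h
  exact congr($h a)

/-- The coordinate vector field of the chart around `y₀` with constant components `a`. -/
noncomputable def coordField (y₀ : M) (a : E) (y : M) : TangentSpace 𝓘(ℝ, E) y :=
  mfderiv 𝓘(ℝ, E) 𝓘(ℝ, E) (extChartAt 𝓘(ℝ, E) y₀).symm (extChartAt 𝓘(ℝ, E) y₀ y) a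

omit [IsManifold 𝓘(ℝ, E) ∞ M] in
theorem coordField_chart_symm {y₀ : M} {u : E} (hu : u ∈ (extChartAt 𝓘(ℝ, E) y₀).target) (a : E) :
    coordField y₀ a ((extChartAt 𝓘(ℝ, E) y₀).symm u) =
      mfderiv 𝓘(ℝ, E) 𝓘(ℝ, E) (extChartAt 𝓘(ℝ, E) y₀).symm u a :=
  congrArg (fun w ↦ (mfderiv 𝓘(ℝ, E) 𝓘(ℝ, E) (extChartAt 𝓘(ℝ, E) y₀).symm w a : E))
    ((extChartAt 𝓘(ℝ, E) y₀).right_inv hu)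

/-- The inverse of the tangent bundle trivialization at `y₀` is, fibrewise, the derivative of the
inverse chart, so the field is the image of the constant section `a` under a smooth map. -/
theorem contMDiffOn_coordField (y₀ : M) (a : E) :
    ContMDiffOn 𝓘(ℝ, E) 𝓘(ℝ, E).tangent ∞
      (fun y ↦ (⟨y, coordField y₀ a y⟩ : TangentBundle 𝓘(ℝ, E) M))
      (extChartAt 𝓘(ℝ, E) y₀).source := by
  have : IsManifold 𝓘(ℝ, E) 1 M := .of_le (n := ∞) (by norm_cast)
  set e := trivializationAt E (TangentSpace 𝓘(ℝ, E) : M → Type _) y₀ with he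
  have hs : (extChartAt 𝓘(ℝ, E) y₀).source = e.baseSet := by
    rw [extChartAt_source]; simp [he]
  have h1 := e.contMDiffOn_symm (IB := 𝓘(ℝ, E)) (n := ∞)
  have h2 : ContMDiffOn 𝓘(ℝ, E) (𝓘(ℝ, E).prod 𝓘(ℝ, E)) ∞ (fun y : M ↦ (y, a)) e.baseSet :=
    contMDiffOn_id.prodMk contMDiffOn_const
  have h3 := h1.comp h2 (fun y hy ↦ by simpa [e.target_eq] using hy)
  rw [hs]
  refine h3.congr fun y hy ↦ ?_
  have hy' : y ∈ (chartAt E y₀).source := by simpa [he] using hy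
  have h4 := TangentBundle.symmL_trivializationAt (I := 𝓘(ℝ, E)) (𝕜 := ℝ) hy'
  rw [modelWithCornersSelf_coe, range_id, mfderivWithin_univ] at h4
  have h5 : e.symmL ℝ y a = coordField y₀ a y := congr($h4 a)
  rw [← h5, e.symmL_apply hy]
  simp [e.mk_symm hy]

/-- A coordinate field is cut off by a bump function equal to `1` at `y₀`. This turns statements
about global smooth fields, such as `∇̄J = 0` or the identity of the theorem, into statements about
single vectors. -/
theorem exists_smoothVectorField_apply_eq [FiniteDimensional ℝ E] [T2Space M] (y₀ : M)
    (a : TangentSpace 𝓘(ℝ, E) y₀) :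
    ∃ Y : (y : M) → TangentSpace 𝓘(ℝ, E) y, IsSmoothVectorField 𝓘(ℝ, E) Y ∧ Y y₀ = a := by
  obtain ⟨ψ⟩ : Nonempty (SmoothBumpFunction 𝓘(ℝ, E) y₀) := inferInstance
  let a' : E := mfderiv 𝓘(ℝ, E) 𝓘(ℝ, E) (extChartAt 𝓘(ℝ, E) y₀) y₀ a
  refine ⟨fun y ↦ ψ y • coordField y₀ a' y, ?_, ?_⟩
  · exact ContMDiffOn.smul_section_of_tsupport (n := ∞) (V := (TangentSpace 𝓘(ℝ, E) : M → Type _))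
      ψ.contMDiff.contMDiffOn
      (isOpen_extChartAt_source y₀) ψ.tsupport_subset_extChartAt_source
      (contMDiffOn_coordField y₀ a')
  · simp only [ψ.eq_one, one_smul]
    exact mfderiv_chart_symm_apply (mem_extChartAt_source y₀) a

theorem contDiffOn_coordMetric [FiniteDimensional ℝ E]
    (g : ContMDiffRiemannianMetric 𝓘(ℝ, E) ∞ E (fun y : M ↦ TangentSpace 𝓘(ℝ, E) y)) (y₀ : M) :
    ContDiffOn ℝ ∞ (coordMetric g y₀) (extChartAt 𝓘(ℝ, E) y₀).target := by
  -- In finite dimension, smoothness of an operator-valued map can be tested on constant vectors,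
  -- here on pairs of coordinate fields.
  refine contDiffOn_clm_apply.2 fun a ↦ contDiffOn_clm_apply.2 fun b ↦ ?_
  have h1 : ContMDiffOn 𝓘(ℝ, E) 𝓘(ℝ, ℝ) ∞
      (fun y ↦ g.inner y (coordField y₀ a y) (coordField y₀ b y))
      (extChartAt 𝓘(ℝ, E) y₀).source := by
    intro y hy
    have h2 := ContMDiffWithinAt.clm_bundle_apply₂ (F₁ := E) (F₂ := E) (F₃ := ℝ)
      (E₃ := Bundle.Trivial M ℝ) (g.contMDiff y).contMDiffWithinAt
      (contMDiffOn_coordField y₀ a y hy) (contMDiffOn_coordField y₀ b y hy)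
    rw [contMDiffWithinAt_totalSpace] at h2
    exact h2.2
  rw [← contMDiffOn_iff_contDiffOn]
  refine (h1.comp (contMDiffOn_extChartAt_symm y₀)
    (fun u hu ↦ (extChartAt 𝓘(ℝ, E) y₀).map_target hu)).congr fun u hu ↦ ?_
  rw [Function.comp_apply, coordField_chart_symm hu, coordField_chart_symm hu]
  rfl

/-- The `(1,1)`-tensor field `J` read in the chart around `y₀`. -/
noncomputable def coordEnd (J : (y : M) → TangentSpace 𝓘(ℝ, E) y →L[ℝ] TangentSpace 𝓘(ℝ, E) y)
    (y₀ : M) (u : E) : E →L[ℝ] E :=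
  let A : E →L[ℝ] TangentSpace 𝓘(ℝ, E) ((extChartAt 𝓘(ℝ, E) y₀).symm u) :=
    mfderiv 𝓘(ℝ, E) 𝓘(ℝ, E) (extChartAt 𝓘(ℝ, E) y₀).symm u
  let B : TangentSpace 𝓘(ℝ, E) ((extChartAt 𝓘(ℝ, E) y₀).symm u) →L[ℝ] E :=
    mfderiv 𝓘(ℝ, E) 𝓘(ℝ, E) (extChartAt 𝓘(ℝ, E) y₀) ((extChartAt 𝓘(ℝ, E) y₀).symm u)
  B ∘L J ((extChartAt 𝓘(ℝ, E) y₀).symm u) ∘L A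

/-- The fibre component of the trivialization at `y₀` is the derivative of the chart; hence the
chart components of a field along `φ` are as smooth as the field. -/
theorem contMDiffOn_mfderiv_chart {N : Type*} {E' H' : Type*} [NormedAddCommGroup E']
    [NormedSpace ℝ E'] [TopologicalSpace H'] {I' : ModelWithCorners ℝ E' H'} [TopologicalSpace N]
    [ChartedSpace H' N] {φ : N → M} {V : (x : N) → TangentSpace 𝓘(ℝ, E) (φ x)} {s : Set N}
    {n : WithTop ℕ∞} (hn : n ≤ ∞) (y₀ : M)
    (hV : ContMDiffOn I' 𝓘(ℝ, E).tangent n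
      (fun x ↦ (⟨φ x, V x⟩ : TangentBundle 𝓘(ℝ, E) M)) s)
    (hs : MapsTo φ s (extChartAt 𝓘(ℝ, E) y₀).source) :
    ContMDiffOn I' 𝓘(ℝ, E) n
      (fun x ↦ (mfderiv 𝓘(ℝ, E) 𝓘(ℝ, E) (extChartAt 𝓘(ℝ, E) y₀) (φ x) (V x) : E)) s := by
  have : IsManifold 𝓘(ℝ, E) 1 M := .of_le (n := ∞) (by norm_cast)
  set e := trivializationAt E (TangentSpace 𝓘(ℝ, E) : M → Type _) y₀ with he
  have h1 : ContMDiffOn 𝓘(ℝ, E).tangent (𝓘(ℝ, E).prod 𝓘(ℝ, E)) n e e.source :=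
    (e.contMDiffOn (IB := 𝓘(ℝ, E)) (n := ∞)).of_le hn
  have hs' : ∀ x ∈ s, φ x ∈ e.baseSet := fun x hx ↦ by
    simpa [he] using hs hx
  have h2 := h1.comp hV (fun x hx ↦ e.mem_source.2 (hs' x hx))
  refine (contMDiff_snd.comp_contMDiffOn h2).congr fun x hx ↦ ?_
  have hx' : φ x ∈ (chartAt E y₀).source := by simpa using hs hx
  have h4 := TangentBundle.continuousLinearMapAt_trivializationAt (I := 𝓘(ℝ, E)) (𝕜 := ℝ) hx'
  have h5 : e.continuousLinearMapAt ℝ (φ x) (V x) =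
    mfderiv 𝓘(ℝ, E) 𝓘(ℝ, E) (extChartAt 𝓘(ℝ, E) y₀) (φ x) (V x) := congr($h4 (V x))
  rw [← h5, e.continuousLinearMapAt_apply ℝ, e.coe_linearMapAt_of_mem (hs' x hx)]
  rfl

theorem contDiffOn_coordEnd [FiniteDimensional ℝ E]
    {J : (y : M) → TangentSpace 𝓘(ℝ, E) y →L[ℝ] TangentSpace 𝓘(ℝ, E) y}
    (hJ : ContMDiff 𝓘(ℝ, E) (𝓘(ℝ, E).prod 𝓘(ℝ, E →L[ℝ] E)) ∞
      (fun y ↦ TotalSpace.mk' (E →L[ℝ] E)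
        (E := fun y : M ↦ TangentSpace 𝓘(ℝ, E) y →L[ℝ] TangentSpace 𝓘(ℝ, E) y) y (J y)))
    (y₀ : M) : ContDiffOn ℝ ∞ (coordEnd J y₀) (extChartAt 𝓘(ℝ, E) y₀).target := by
  refine contDiffOn_clm_apply.2 fun a ↦ ?_
  have h1 := contMDiffOn_mfderiv_chart le_rfl y₀ (φ := fun y ↦ y)
    (hJ.contMDiffOn.clm_bundle_apply (contMDiffOn_coordField y₀ a)) (fun y hy ↦ hy)
  rw [← contMDiffOn_iff_contDiffOn]
  refine (h1.comp (contMDiffOn_extChartAt_symm y₀)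
    (fun u hu ↦ (extChartAt 𝓘(ℝ, E) y₀).map_target hu)).congr fun u hu ↦ ?_
  exact congrArg (fun w : TangentSpace 𝓘(ℝ, E) ((extChartAt 𝓘(ℝ, E) y₀).symm u) ↦
    (mfderiv 𝓘(ℝ, E) 𝓘(ℝ, E) (extChartAt 𝓘(ℝ, E) y₀) ((extChartAt 𝓘(ℝ, E) y₀).symm u)
      (J ((extChartAt 𝓘(ℝ, E) y₀).symm u) w) : E)) (coordField_chart_symm hu a).symm

end Charts

/-! ### Koszul's formula for a pulled-back warped metric in vector spaces -/

section Calculus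

variable {E : Type*} [NormedAddCommGroup E] [NormedSpace ℝ E]
  {E₁ : Type*} [NormedAddCommGroup E₁] [NormedSpace ℝ E₁]
  {E₂ : Type*} [NormedAddCommGroup E₂] [NormedSpace ℝ E₂]

set_option synthInstance.maxHeartbeats 200000 in
theorem hasFDerivAt_bilin_comp {V W : Type*} [NormedAddCommGroup V] [NormedSpace ℝ V]
    [NormedAddCommGroup W] [NormedSpace ℝ W] {F : W → V} {F' : W →L[ℝ] V}
    {G : V → V →L[ℝ] V →L[ℝ] ℝ} {w : W} (hG : DifferentiableAt ℝ G (F w))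
    (hF : HasFDerivAt F F' w) :
    HasFDerivAt (fun w ↦ G (F w)) (fderiv ℝ G (F w) ∘L F') w :=
  HasFDerivAt.comp (G := V →L[ℝ] V →L[ℝ] ℝ) (g := G) w hG.hasFDerivAt hF

set_option synthInstance.maxHeartbeats 200000 in
/-- The derivative of a warped product metric pulled back by a `C²` map. -/
theorem fderiv_pullback_metric {F : E₁ × E₂ → E} {G : E → E →L[ℝ] E →L[ℝ] ℝ}
    {G₁ : E₁ → E₁ →L[ℝ] E₁ →L[ℝ] ℝ} {G₂ : E₂ → E₂ →L[ℝ] E₂ →L[ℝ] ℝ} {φ : E₁ → ℝ} {w₀ : E₁ × E₂}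
    (hF : ContDiffAt ℝ 2 F w₀) (hG : DifferentiableAt ℝ G (F w₀))
    (hG₁ : DifferentiableAt ℝ G₁ w₀.1) (hG₂ : DifferentiableAt ℝ G₂ w₀.2)
    (hφ : DifferentiableAt ℝ φ w₀.1)
    (hiso : ∀ᶠ w in 𝓝 w₀, ∀ α β, G (F w) (fderiv ℝ F w α) (fderiv ℝ F w β) =
      G₁ w.1 α.1 β.1 + φ w.1 ^ 2 * G₂ w.2 α.2 β.2) (δ α β : E₁ × E₂) :
    fderiv ℝ G (F w₀) (fderiv ℝ F w₀ δ) (fderiv ℝ F w₀ α) (fderiv ℝ F w₀ β) +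
      G (F w₀) (fderiv ℝ (fderiv ℝ F) w₀ δ α) (fderiv ℝ F w₀ β) +
      G (F w₀) (fderiv ℝ F w₀ α) (fderiv ℝ (fderiv ℝ F) w₀ δ β) =
    fderiv ℝ G₁ w₀.1 δ.1 α.1 β.1 +
      (2 * φ w₀.1 * fderiv ℝ φ w₀.1 δ.1 * G₂ w₀.2 α.2 β.2 +
        φ w₀.1 ^ 2 * fderiv ℝ G₂ w₀.2 δ.2 α.2 β.2) := by
  have hD : HasFDerivAt F (fderiv ℝ F w₀) w₀ := (hF.differentiableAt two_ne_zero).hasFDerivAt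
  have hDD : HasFDerivAt (fderiv ℝ F) (fderiv ℝ (fderiv ℝ F) w₀) w₀ :=
    ((hF.fderiv_right (m := 1) (by norm_num)).differentiableAt one_ne_zero).hasFDerivAt
  have hα := hDD.clm_apply (hasFDerivAt_const α w₀)
  have hβ := hDD.clm_apply (hasFDerivAt_const β w₀)
  have hGF := hasFDerivAt_bilin_comp hG hD
  have hL' := hGF.clm_apply hα
  have hL := hL'.clm_apply hβ
  have hG₁' := hasFDerivAt_bilin_comp (F := Prod.fst) hG₁ (hasFDerivAt_fst (p := w₀))
  have hG₂' := hasFDerivAt_bilin_comp (F := Prod.snd) hG₂ (hasFDerivAt_snd (p := w₀))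
  have h₁' := hG₁'.clm_apply (hasFDerivAt_const α.1 w₀)
  have h₁ := h₁'.clm_apply (hasFDerivAt_const β.1 w₀)
  have h₂' := hG₂'.clm_apply (hasFDerivAt_const α.2 w₀)
  have h₂ := h₂'.clm_apply (hasFDerivAt_const β.2 w₀)
  have h₃ := ((hφ.hasFDerivAt.comp w₀ hasFDerivAt_fst).pow 2).mul h₂
  -- Both sides of the isometry identity agree near `w₀`, so uniqueness of the derivative equates
  -- the two product rule expansions.
  have hR := (h₁.add h₃).congr_of_eventuallyEq (hiso.mono fun w hw ↦ hw α β)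
  have := congr($(hL.unique hR) δ)
  simp at this
  linarith

set_option synthInstance.maxHeartbeats 200000 in
/-- Koszul's formula, in coordinates, for a horizontal and a vertical constant vector. -/
theorem koszul_warped {F : E₁ × E₂ → E} {G : E → E →L[ℝ] E →L[ℝ] ℝ}
    {G₁ : E₁ → E₁ →L[ℝ] E₁ →L[ℝ] ℝ} {G₂ : E₂ → E₂ →L[ℝ] E₂ →L[ℝ] ℝ} {φ : E₁ → ℝ} {w₀ : E₁ × E₂}
    (hF : ContDiffAt ℝ 2 F w₀) (hG : DifferentiableAt ℝ G (F w₀))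
    (hGs : ∀ a b, G (F w₀) a b = G (F w₀) b a)
    (hG₁ : DifferentiableAt ℝ G₁ w₀.1) (hG₂ : DifferentiableAt ℝ G₂ w₀.2)
    (hφ : DifferentiableAt ℝ φ w₀.1)
    (hiso : ∀ᶠ w in 𝓝 w₀, ∀ α β, G (F w) (fderiv ℝ F w α) (fderiv ℝ F w β) =
      G₁ w.1 α.1 β.1 + φ w.1 ^ 2 * G₂ w.2 α.2 β.2) (a : E₁) (b : E₂) (γ : E₁ × E₂) :
    2 * G (F w₀) (fderiv ℝ (fderiv ℝ F) w₀ (0, b) (a, 0)) (fderiv ℝ F w₀ γ) +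
      (fderiv ℝ G (F w₀) (fderiv ℝ F w₀ (0, b)) (fderiv ℝ F w₀ (a, 0)) (fderiv ℝ F w₀ γ) +
        fderiv ℝ G (F w₀) (fderiv ℝ F w₀ (a, 0)) (fderiv ℝ F w₀ (0, b)) (fderiv ℝ F w₀ γ) -
        fderiv ℝ G (F w₀) (fderiv ℝ F w₀ γ) (fderiv ℝ F w₀ (0, b)) (fderiv ℝ F w₀ (a, 0))) =
    2 * φ w₀.1 * fderiv ℝ φ w₀.1 a * G₂ w₀.2 b γ.2 := by
  have hs : IsSymmSndFDerivAt ℝ F w₀ := hF.isSymmSndFDerivAt (by simp)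
  -- The Koszul combination is `k₁ + k₂ - k₃`. Mixed pairs are orthogonal and each factor metric
  -- depends only on its own variable, so the right sides of `k₁` and `k₃` vanish; in `k₂` only the
  -- derivative of `φ ^ 2` along `a` survives.
  have k₁ := fderiv_pullback_metric hF hG hG₁ hG₂ hφ hiso (0, b) (a, 0) γ
  have k₂ := fderiv_pullback_metric hF hG hG₁ hG₂ hφ hiso (a, 0) (0, b) γ
  have k₃ := fderiv_pullback_metric hF hG hG₁ hG₂ hφ hiso γ (0, b) (a, 0)
  rw [hs.eq (0, b) (a, 0)] at k₁ ⊢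
  rw [hs.eq γ (0, b), hs.eq γ (a, 0)] at k₃
  have e₁ := hGs (fderiv ℝ (fderiv ℝ F) w₀ (0, b) γ) (fderiv ℝ F w₀ (a, 0))
  simp only [map_zero, zero_apply, mul_zero, add_zero, zero_add] at k₁ k₂ k₃
  linarith

end Calculus

/-! ### Christoffel symbols of a Riemannian metric -/

section Christoffel

variable {E : Type*} [NormedAddCommGroup E] [NormedSpace ℝ E] [FiniteDimensional ℝ E]
  {M : Type*} [TopologicalSpace M] [ChartedSpace E M] [IsManifold 𝓘(ℝ, E) ∞ M]
  (g : ContMDiffRiemannianMetric 𝓘(ℝ, E) ∞ E (fun y : M ↦ TangentSpace 𝓘(ℝ, E) y)) {y₀ : M}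

omit [FiniteDimensional ℝ E] in
theorem coordMetric_symm (y₀ : M) (u a b : E) :
    coordMetric g y₀ u a b = coordMetric g y₀ u b a :=
  g.symm _ _ _

/-- Positive definiteness gives injectivity, and `E` and its dual have the same dimension. Without
invertibility the `inverse` in `christoffel` would take its default value `0`. -/
theorem isInvertible_coordMetric {u : E} (hu : u ∈ (extChartAt 𝓘(ℝ, E) y₀).target) :
    (coordMetric g y₀ u).IsInvertible := by
  have hinj : Function.Injective (coordMetric g y₀ u) := by
    refine (injective_iff_map_eq_zero _).2 fun a ha ↦ ?_
    by_contra hne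
    have hS : (mfderiv 𝓘(ℝ, E) 𝓘(ℝ, E) (extChartAt 𝓘(ℝ, E) y₀).symm u) a ≠ 0 := by
      intro h0
      have h1 := mfderiv_chart_apply_symm hu a
      rw [h0, map_zero] at h1
      exact hne h1.symm
    exact (g.pos _ _ hS).ne' congr($ha a)
  have hfr : Module.finrank ℝ E = Module.finrank ℝ (E →L[ℝ] ℝ) := by
    rw [← (LinearMap.toContinuousLinearMap (𝕜 := ℝ) (E := E) (F' := ℝ)).finrank_eq]
    exact Subspace.dual_finrank_eq.symm
  let L := LinearEquiv.ofInjectiveOfFinrankEq (coordMetric g y₀ u).toLinearMap hinj hfr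
  exact ⟨L.toContinuousLinearEquiv, by ext; rfl⟩

theorem differentiableAt_coordMetric {u : E} (hu : u ∈ (extChartAt 𝓘(ℝ, E) y₀).target) :
    DifferentiableAt ℝ (coordMetric g y₀) u :=
  ((contDiffOn_coordMetric g y₀).contDiffAt
    ((isOpen_extChartAt_target y₀).mem_nhds hu)).differentiableAt (by simp)

theorem coordMetric_christoffel {u : E} (hu : u ∈ (extChartAt 𝓘(ℝ, E) y₀).target) (a b c : E) :
    2 * coordMetric g y₀ u (christoffel g y₀ u a b) c =
      fderiv ℝ (coordMetric g y₀) u a b c + fderiv ℝ (coordMetric g y₀) u b a c -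
        fderiv ℝ (coordMetric g y₀) u c a b := by
  have h := (isInvertible_coordMetric g hu).self_apply_inverse
  simp [christoffel, h]

set_option synthInstance.maxHeartbeats 200000 in
theorem fderiv_coordMetric_symm {u : E} (hu : u ∈ (extChartAt 𝓘(ℝ, E) y₀).target) (c a b : E) :
    fderiv ℝ (coordMetric g y₀) u c a b = fderiv ℝ (coordMetric g y₀) u c b a := by
  have h := (differentiableAt_coordMetric g hu).hasFDerivAt
  have h1 := (h.clm_apply (hasFDerivAt_const a u)).clm_apply (hasFDerivAt_const b u)
  have h2 := (h.clm_apply (hasFDerivAt_const b u)).clm_apply (hasFDerivAt_const a u)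
  have h3 := congr($(h1.unique (h2.congr_of_eventuallyEq
    (.of_forall fun v ↦ coordMetric_symm g y₀ v a b))) c)
  simpa using h3

set_option synthInstance.maxHeartbeats 200000 in
-- This is torsion-freeness: the first two terms are exchanged, and the third is fixed because the
-- derivative of the metric is a symmetric form.
theorem christoffel_symm {u : E} (hu : u ∈ (extChartAt 𝓘(ℝ, E) y₀).target) (a b : E) :
    christoffel g y₀ u a b = christoffel g y₀ u b a := by
  simp only [christoffel]
  congr 2
  ext c
  simp [fderiv_coordMetric_symm g hu c a b, add_comm]

end Christoffel

/-! ### Parallelism of `J` for fields along a map -/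

section Parallel

variable {E : Type*} [NormedAddCommGroup E] [NormedSpace ℝ E]
  {M : Type*} [TopologicalSpace M] [ChartedSpace E M]
  {E' : Type*} [NormedAddCommGroup E'] [NormedSpace ℝ E']
  {H' : Type*} [TopologicalSpace H'] {I' : ModelWithCorners ℝ E' H'}
  {N : Type*} [TopologicalSpace N] [ChartedSpace H' N]

/-- The derivative of a function with values in a normed space. -/
noncomputable def vderiv (I' : ModelWithCorners ℝ E' H') (W : N → E) (x : N)
    (v : TangentSpace I' x) : E :=
  mfderiv I' 𝓘(ℝ, E) W x v

theorem vderiv_clm_apply {c W : N → E} {A : E → E →L[ℝ] E} {x : N}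
    (hc : MDifferentiableAt I' 𝓘(ℝ, E) c x) (hW : MDifferentiableAt I' 𝓘(ℝ, E) W x)
    (hA : DifferentiableAt ℝ A (c x)) (v : TangentSpace I' x) :
    vderiv I' (fun x' ↦ A (c x') (W x')) x v =
      fderiv ℝ A (c x) (vderiv I' c x v) (W x) + A (c x) (vderiv I' W x v) := by
  -- Manifold derivatives are derivatives within `range I'` of functions composed with the inverse
  -- chart; their base point is `x` only after this rewriting.
  have hx : (extChartAt I' x).symm (extChartAt I' x x) = x := extChartAt_to_inv x
  have hA' : HasFDerivAt A (fderiv ℝ A (c x))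
    (c ((extChartAt I' x).symm (extChartAt I' x x))) := by
    rw [hx]; exact hA.hasFDerivAt
  let c' : E' →L[ℝ] E := mfderiv I' 𝓘(ℝ, E) c x
  let W' : E' →L[ℝ] E := mfderiv I' 𝓘(ℝ, E) W x
  have hc' : HasFDerivWithinAt (c ∘ (extChartAt I' x).symm) c' (range I') (extChartAt I' x x) :=
    hc.hasMFDerivAt.2
  have hW' : HasFDerivWithinAt (W ∘ (extChartAt I' x).symm) W' (range I') (extChartAt I' x x) :=
    hW.hasMFDerivAt.2
  have h := (hA'.comp_hasFDerivWithinAt (extChartAt I' x x) hc').clm_apply hW'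
  have hM : HasMFDerivAt I' 𝓘(ℝ, E) (fun x' ↦ A (c x') (W x')) x _ :=
    ⟨(hA.continuousAt.comp hc.continuousAt).clm_apply hW.continuousAt, h⟩
  have h2 : vderiv I' (fun x' ↦ A (c x') (W x')) x v = _ := congr($(hM.mfderiv) v)
  rw [h2]
  change A (c ((extChartAt I' x).symm (extChartAt I' x x))) (W' v) +
    fderiv ℝ A (c x) (c' v) (W ((extChartAt I' x).symm (extChartAt I' x x))) = _
  rw [hx, add_comm]
  rfl

/-- The components of a tangent vector in the chart around `y₀`. -/
noncomputable def chartVec (y₀ y : M) : TangentSpace 𝓘(ℝ, E) y →L[ℝ] E :=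
  mfderiv 𝓘(ℝ, E) 𝓘(ℝ, E) (extChartAt 𝓘(ℝ, E) y₀) y

variable [IsManifold 𝓘(ℝ, E) ∞ M]

theorem chartVec_coordField {y₀ y : M} (hy : y ∈ (extChartAt 𝓘(ℝ, E) y₀).source) (a : E) :
    chartVec y₀ y (coordField y₀ a y) = a :=
  mfderiv_chart_apply_symm' hy a

theorem coordField_chartVec {y₀ y : M} (hy : y ∈ (extChartAt 𝓘(ℝ, E) y₀).source)
    (v : TangentSpace 𝓘(ℝ, E) y) : coordField y₀ (chartVec y₀ y v) y = v :=
  mfderiv_chart_symm_apply hy v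

theorem chartVec_injective {y₀ y : M} (hy : y ∈ (extChartAt 𝓘(ℝ, E) y₀).source) :
    Function.Injective (chartVec (E := E) y₀ y) :=
  Function.LeftInverse.injective (coordField_chartVec hy)

theorem vderiv_chart_comp {φ : N → M} {x : N} (hφ : MDifferentiableAt I' 𝓘(ℝ, E) φ x) {y₀ : M}
    (hs : φ x ∈ (extChartAt 𝓘(ℝ, E) y₀).source) (v : TangentSpace I' x) :
    vderiv I' (fun x' ↦ extChartAt 𝓘(ℝ, E) y₀ (φ x')) x v =
      chartVec y₀ (φ x) (mfderiv I' 𝓘(ℝ, E) φ x v) := by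
  have : IsManifold 𝓘(ℝ, E) 1 M := .of_le (n := ∞) (by norm_cast)
  have he : MDifferentiableAt 𝓘(ℝ, E) 𝓘(ℝ, E) (extChartAt 𝓘(ℝ, E) y₀) (φ x) :=
    mdifferentiableAt_extChartAt (by simpa using hs)
  have h := mfderiv_comp x he hφ
  exact congr($h v)

/-- The components, in the chart around `φ x`, of a vector field `V` along `φ`. -/
noncomputable def compAlong (φ : N → M) (V : (x : N) → TangentSpace 𝓘(ℝ, E) (φ x)) (x x' : N) : E :=
  chartVec (φ x) (φ x') (V x')

theorem chartVec_covDerivAlong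
    (g : ContMDiffRiemannianMetric 𝓘(ℝ, E) ∞ E (fun y : M ↦ TangentSpace 𝓘(ℝ, E) y))
    (φ : N → M) (V : (x : N) → TangentSpace 𝓘(ℝ, E) (φ x)) (x : N) (v : TangentSpace I' x) :
    chartVec (φ x) (φ x) (covDerivAlong I' g φ V x v) =
      vderiv I' (compAlong φ V x) x v +
        christoffel g (φ x) (extChartAt 𝓘(ℝ, E) (φ x) (φ x))
          (chartVec (φ x) (φ x) (mfderiv I' 𝓘(ℝ, E) φ x v)) (compAlong φ V x x) := by
  have : IsManifold 𝓘(ℝ, E) 1 M := .of_le (n := ∞) (by norm_cast)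
  exact (isInvertible_mfderiv_extChartAt (I := 𝓘(ℝ, E))
    (mem_extChartAt_source (φ x))).self_apply_inverse _

theorem coordEnd_chartVec {y₀ y : M} (hy : y ∈ (extChartAt 𝓘(ℝ, E) y₀).source)
    (J : (y : M) → TangentSpace 𝓘(ℝ, E) y →L[ℝ] TangentSpace 𝓘(ℝ, E) y)
    (v : TangentSpace 𝓘(ℝ, E) y) :
    coordEnd J y₀ (extChartAt 𝓘(ℝ, E) y₀ y) (chartVec y₀ y v) = chartVec y₀ y (J y v) := by
  -- The tangent space depends on the base point, and the chart followed by its inverse returns `y`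
  -- only propositionally. Generalizing over the base point allows the substitution.
  have key : ∀ (y' : M) (w : E), y' = y → w = coordField y₀ (chartVec y₀ y v) y →
      chartVec y₀ y' (J y' w) = chartVec y₀ y (J y v) := by
    rintro y' _ rfl rfl
    rw [coordField_chartVec hy]
  exact key _ _ ((extChartAt 𝓘(ℝ, E) y₀).left_inv hy) rfl

variable [FiniteDimensional ℝ E]
  {J : (y : M) → TangentSpace 𝓘(ℝ, E) y →L[ℝ] TangentSpace 𝓘(ℝ, E) y}

theorem vderiv_compAlong_end
    (hJ : ContMDiff 𝓘(ℝ, E) (𝓘(ℝ, E).prod 𝓘(ℝ, E →L[ℝ] E)) ∞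
      (fun y ↦ TotalSpace.mk' (E →L[ℝ] E)
        (E := fun y : M ↦ TangentSpace 𝓘(ℝ, E) y →L[ℝ] TangentSpace 𝓘(ℝ, E) y) y (J y)))
    {φ : N → M} {V : (x : N) → TangentSpace 𝓘(ℝ, E) (φ x)} {x : N}
    (hφ : MDifferentiableAt I' 𝓘(ℝ, E) φ x)
    (hV : MDifferentiableAt I' 𝓘(ℝ, E) (compAlong φ V x) x) (v : TangentSpace I' x) :
    vderiv I' (compAlong φ (fun x ↦ J (φ x) (V x)) x) x v =
      fderiv ℝ (coordEnd J (φ x)) (extChartAt 𝓘(ℝ, E) (φ x) (φ x))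
        (chartVec (φ x) (φ x) (mfderiv I' 𝓘(ℝ, E) φ x v)) (compAlong φ V x x) +
      coordEnd J (φ x) (extChartAt 𝓘(ℝ, E) (φ x) (φ x)) (vderiv I' (compAlong φ V x) x v) := by
  have : IsManifold 𝓘(ℝ, E) 1 M := .of_le (n := ∞) (by norm_cast)
  have hev : compAlong φ (fun x ↦ J (φ x) (V x)) x =ᶠ[𝓝 x]
      fun x' ↦ coordEnd J (φ x) (extChartAt 𝓘(ℝ, E) (φ x) (φ x')) (compAlong φ V x x') := by
    filter_upwards [hφ.continuousAt.preimage_mem_nhds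
      (extChartAt_source_mem_nhds (I := 𝓘(ℝ, E)) (φ x))] with x' hx'
    exact (coordEnd_chartVec hx' J (V x')).symm
  have he : MDifferentiableAt I' 𝓘(ℝ, E) (fun x' ↦ extChartAt 𝓘(ℝ, E) (φ x) (φ x')) x :=
    (mdifferentiableAt_extChartAt (mem_chart_source E (φ x))).comp x hφ
  have hJd : DifferentiableAt ℝ (coordEnd J (φ x)) (extChartAt 𝓘(ℝ, E) (φ x) (φ x)) :=
    ((contDiffOn_coordEnd hJ (φ x)).contDiffAt ((isOpen_extChartAt_target (φ x)).mem_nhds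
      (mem_extChartAt_target (φ x)))).differentiableAt (by simp)
  rw [← vderiv_chart_comp hφ (mem_extChartAt_source (φ x)), ← vderiv_clm_apply he hV hJd v]
  exact congr($(hev.mfderiv_eq) v)

variable [T2Space M] {p q : ℕ}
    {g : ContMDiffRiemannianMetric 𝓘(ℝ, E) ∞ E (fun y : M ↦ TangentSpace 𝓘(ℝ, E) y)}

/-- The equation `∇̄J = 0` in components at the centre of the chart. It is tensorial in `b`, so one
global smooth field with value `b` at `y₀` suffices. The centre is enough because `covDerivAlong`
always uses the chart centred at the point of evaluation. -/
theorem IsLocallyMetallicRiemannian.fderiv_coordEnd (hJ : IsLocallyMetallicRiemannian p q g J)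
    (y₀ : M) (w b : E) :
    fderiv ℝ (coordEnd J y₀) (extChartAt 𝓘(ℝ, E) y₀ y₀) w b +
      christoffel g y₀ (extChartAt 𝓘(ℝ, E) y₀ y₀) w
        (coordEnd J y₀ (extChartAt 𝓘(ℝ, E) y₀ y₀) b) =
    coordEnd J y₀ (extChartAt 𝓘(ℝ, E) y₀ y₀)
      (christoffel g y₀ (extChartAt 𝓘(ℝ, E) y₀ y₀) w b) := by
  have hs := mem_extChartAt_source (I := 𝓘(ℝ, E)) y₀
  obtain ⟨Y, hY, hYb⟩ := exists_smoothVectorField_apply_eq y₀ (coordField y₀ b y₀)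
  have hYd : MDifferentiableAt 𝓘(ℝ, E) 𝓘(ℝ, E) (compAlong (fun y ↦ y) Y y₀) y₀ :=
    (((contMDiffOn_mfderiv_chart le_rfl y₀ (φ := fun y ↦ y) hY.contMDiffOn
      (fun y hy ↦ hy)) y₀ hs).contMDiffAt
      (extChartAt_source_mem_nhds y₀)).mdifferentiableAt (by simp)
  have hYc : compAlong (fun y ↦ y) Y y₀ y₀ = b := by
    rw [compAlong, hYb]
    exact chartVec_coordField hs b
  have hv : chartVec y₀ y₀
      (mfderiv 𝓘(ℝ, E) 𝓘(ℝ, E) (fun y : M ↦ y) y₀ (coordField y₀ w y₀)) = w := by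
    have : mfderiv 𝓘(ℝ, E) 𝓘(ℝ, E) (fun y : M ↦ y) y₀ = ContinuousLinearMap.id ℝ _ := mfderiv_id
    rw [this]
    exact chartVec_coordField hs w
  have h1 := congrArg (chartVec y₀ y₀) (hJ.parallel Y hY y₀ (coordField y₀ w y₀))
  rw [← coordEnd_chartVec hs] at h1
  have h2 := chartVec_covDerivAlong (I' := 𝓘(ℝ, E)) g (fun y ↦ y) Y y₀ (coordField y₀ w y₀)
  have h3 := chartVec_covDerivAlong (I' := 𝓘(ℝ, E)) g (fun y ↦ y) (fun y ↦ J y (Y y)) y₀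
    (coordField y₀ w y₀)
  have h4 := vderiv_compAlong_end (I' := 𝓘(ℝ, E)) hJ.smooth (φ := fun y : M ↦ y)
    mdifferentiableAt_id hYd (coordField y₀ w y₀)
  have h5 : compAlong (fun y ↦ y) (fun y ↦ J y (Y y)) y₀ y₀ =
    coordEnd J y₀ (extChartAt 𝓘(ℝ, E) y₀ y₀) (compAlong (fun y ↦ y) Y y₀ y₀) :=
      (coordEnd_chartVec hs J (Y y₀)).symm
  rw [hv, hYc] at h2 h4
  rw [hv, h4, h5, hYc] at h3
  have h6 := h3.symm.trans (h1.trans (congrArg _ h2))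
  -- The derivative of the components of `Y` enters both sides through the same term, its image
  -- under `J`, and cancels.
  rw [map_add, add_right_comm, add_comm] at h6
  exact add_left_cancel h6

/-- The product rule for the components of `J V` leaves a term in the derivative of `J`, which
`fderiv_coordEnd` trades for Christoffel terms. No extension of `V` to the ambient manifold is
needed. -/
theorem IsLocallyMetallicRiemannian.covDerivAlong_apply (hJ : IsLocallyMetallicRiemannian p q g J)
    {φ : N → M} {V : (x : N) → TangentSpace 𝓘(ℝ, E) (φ x)} {x : N}
    (hφ : MDifferentiableAt I' 𝓘(ℝ, E) φ x)
    (hV : MDifferentiableAt I' 𝓘(ℝ, E) (compAlong φ V x) x) (v : TangentSpace I' x) :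
    covDerivAlong I' g φ (fun x ↦ J (φ x) (V x)) x v = J (φ x) (covDerivAlong I' g φ V x v) := by
  have hs := mem_extChartAt_source (I := 𝓘(ℝ, E)) (φ x)
  apply chartVec_injective hs
  have h5 : compAlong φ (fun x ↦ J (φ x) (V x)) x x =
    coordEnd J (φ x) (extChartAt 𝓘(ℝ, E) (φ x) (φ x)) (compAlong φ V x x) :=
      (coordEnd_chartVec hs J (V x)).symm
  rw [← coordEnd_chartVec hs, chartVec_covDerivAlong, chartVec_covDerivAlong,
    vderiv_compAlong_end hJ.smooth hφ hV v, h5, map_add, ← hJ.fderiv_coordEnd]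
  abel

end Parallel

/-! ### Local expressions of a smooth map and of tangent fields along it -/

section Local

variable {E : Type*} [NormedAddCommGroup E] [NormedSpace ℝ E]
  {M : Type*} [TopologicalSpace M] [ChartedSpace E M] [IsManifold 𝓘(ℝ, E) ∞ M]
  {E' : Type*} [NormedAddCommGroup E'] [NormedSpace ℝ E']
  {H' : Type*} [TopologicalSpace H'] {I' : ModelWithCorners ℝ E' H'}
  {N : Type*} [TopologicalSpace N] [ChartedSpace H' N]

/-- The components of a tangent vector of `N` in the chart around `z`. -/
noncomputable def sourceVec (I' : ModelWithCorners ℝ E' H') (z x : N) :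
    TangentSpace I' x →L[ℝ] E' :=
  mfderiv I' 𝓘(ℝ, E') (extChartAt I' z) x

theorem mdifferentiableAt_of_eventuallyEq_chart [IsManifold I' 1 N] {W : N → E} {K : E' → E}
    {z : N} (hK : DifferentiableAt ℝ K (extChartAt I' z z))
    (h : W =ᶠ[𝓝 z] fun x ↦ K (extChartAt I' z x)) : MDifferentiableAt I' 𝓘(ℝ, E) W z :=
  (MDifferentiableAt.comp z (g := K) hK.mdifferentiableAt
    (mdifferentiableAt_extChartAt (mem_chart_source H' z))).congr_of_eventuallyEq h

theorem vderiv_of_eventuallyEq_chart [IsManifold I' 1 N] {W : N → E} {K : E' → E} {z x : N}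
    (hx : x ∈ (extChartAt I' z).source) (hK : DifferentiableAt ℝ K (extChartAt I' z x))
    (h : W =ᶠ[𝓝 x] fun x ↦ K (extChartAt I' z x)) (v : TangentSpace I' x) :
    vderiv I' W x v = fderiv ℝ K (extChartAt I' z x) (sourceVec I' z x v) := by
  have h1 := mfderiv_comp x (g := K) hK.mdifferentiableAt
    (mdifferentiableAt_extChartAt (I := I') (x := z) (y := x) (by simpa using hx))
  rw [mfderiv_eq_fderiv] at h1
  exact (congr($(h.mfderiv_eq) v)).trans congr($h1 v)

omit [IsManifold 𝓘(ℝ, E) ∞ M] in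
theorem contDiffAt_writtenInExtChartAt [I'.Boundaryless] {i : N → M} {z : N}
    (hi : ContMDiffAt I' 𝓘(ℝ, E) ∞ i z) :
    ContDiffAt ℝ ∞ (writtenInExtChartAt I' 𝓘(ℝ, E) z i) (extChartAt I' z z) := by
  have h := (contMDiffAt_iff.1 hi).2
  rwa [I'.range_eq_univ, contDiffWithinAt_univ] at h

variable [IsManifold I' ∞ N] [I'.Boundaryless]

/-- The components of `i_* v` are obtained from those of `v` by the derivative of the local
expression of `i`. -/
theorem eventually_chartVec_mfderiv {i : N → M} (hi : ContMDiff I' 𝓘(ℝ, E) ∞ i) (z : N) :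
    ∀ᶠ x in 𝓝 z, ∀ v : TangentSpace I' x,
      chartVec (i z) (i x) (mfderiv I' 𝓘(ℝ, E) i x v) =
        fderiv ℝ (writtenInExtChartAt I' 𝓘(ℝ, E) z i) (extChartAt I' z x) (sourceVec I' z x v) := by
  have : IsManifold I' 1 N := .of_le (n := ∞) (by norm_cast)
  have hF := ((contDiffAt_writtenInExtChartAt (hi z)).of_le
    (m := 1) (by norm_cast)).eventually (by simp)
  have hF' := (continuousAt_extChartAt (I := I') z).eventually hF
  have hs : ∀ᶠ x in 𝓝 z, i x ∈ (extChartAt 𝓘(ℝ, E) (i z)).source :=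
    (hi z).continuousAt.preimage_mem_nhds (extChartAt_source_mem_nhds (i z))
  filter_upwards [hF', hs, extChartAt_source_mem_nhds (I := I') z] with x hx hsx hxz v
  rw [← vderiv_chart_comp ((hi x).mdifferentiableAt (by simp)) hsx v]
  refine vderiv_of_eventuallyEq_chart hxz (hx.differentiableAt one_ne_zero) ?_ v
  filter_upwards [(isOpen_extChartAt_source z).mem_nhds hxz] with x' hx'
  simp only [writtenInExtChartAt, Function.comp_apply, (extChartAt I' z).left_inv hx']

theorem eventually_compAlong_eq {i : N → M} (hi : ContMDiff I' 𝓘(ℝ, E) ∞ i) {z : N}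
    {V : (x : N) → TangentSpace I' x} {A : E' → E'}
    (hV : ∀ᶠ x in 𝓝 z, sourceVec I' z x (V x) = A (extChartAt I' z x)) :
    compAlong i (fun x ↦ mfderiv I' 𝓘(ℝ, E) i x (V x)) z =ᶠ[𝓝 z] fun x ↦
      fderiv ℝ (writtenInExtChartAt I' 𝓘(ℝ, E) z i) (extChartAt I' z x)
        (A (extChartAt I' z x)) := by
  filter_upwards [eventually_chartVec_mfderiv hi z, hV] with x h1 h2
  rw [compAlong, h1, h2]

theorem mdifferentiableAt_compAlong {i : N → M} (hi : ContMDiff I' 𝓘(ℝ, E) ∞ i) {z : N}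
    {V : (x : N) → TangentSpace I' x} {A : E' → E'} (hA : DifferentiableAt ℝ A (extChartAt I' z z))
    (hV : ∀ᶠ x in 𝓝 z, sourceVec I' z x (V x) = A (extChartAt I' z x)) :
    MDifferentiableAt I' 𝓘(ℝ, E) (compAlong i (fun x ↦ mfderiv I' 𝓘(ℝ, E) i x (V x)) z) z := by
  have : IsManifold I' 1 N := .of_le (n := ∞) (by norm_cast)
  have hDF := (((contDiffAt_writtenInExtChartAt (hi z)).fderiv_right
    (m := 1) (by norm_cast)).differentiableAt one_ne_zero)
  exact mdifferentiableAt_of_eventuallyEq_chart (hDF.clm_apply hA) (eventually_compAlong_eq hi hV)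

/-- The Levi-Civita derivative of a tangent vector field along an immersion, in coordinates. -/
theorem chartVec_covDerivAlong_mfderiv
    (g : ContMDiffRiemannianMetric 𝓘(ℝ, E) ∞ E (fun y : M ↦ TangentSpace 𝓘(ℝ, E) y))
    {i : N → M} (hi : ContMDiff I' 𝓘(ℝ, E) ∞ i) {z : N}
    {V : (x : N) → TangentSpace I' x} {A : E' → E'} (hA : DifferentiableAt ℝ A (extChartAt I' z z))
    (hV : ∀ᶠ x in 𝓝 z, sourceVec I' z x (V x) = A (extChartAt I' z x)) (v : TangentSpace I' z) :
    let F := writtenInExtChartAt I' 𝓘(ℝ, E) z i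
    let w := extChartAt I' z z
    chartVec (i z) (i z) (covDerivAlong I' g i (fun x ↦ mfderiv I' 𝓘(ℝ, E) i x (V x)) z v) =
      fderiv ℝ (fderiv ℝ F) w (sourceVec I' z z v) (sourceVec I' z z (V z)) +
        fderiv ℝ F w (fderiv ℝ A w (sourceVec I' z z v)) +
        christoffel g (i z) (F w) (fderiv ℝ F w (sourceVec I' z z v))
          (fderiv ℝ F w (sourceVec I' z z (V z))) := by
  intro F w
  have : IsManifold I' 1 N := .of_le (n := ∞) (by norm_cast)
  have hDF : DifferentiableAt ℝ (fderiv ℝ F) w :=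
    (((contDiffAt_writtenInExtChartAt (hi z)).fderiv_right
      (m := 1) (by norm_cast)).differentiableAt one_ne_zero)
  have hFw : F w = extChartAt 𝓘(ℝ, E) (i z) (i z) := by simp [F, w, writtenInExtChartAt]
  rw [chartVec_covDerivAlong, vderiv_of_eventuallyEq_chart (mem_extChartAt_source z)
    (hDF.clm_apply hA) (eventually_compAlong_eq hi hV), compAlong,
    (eventually_chartVec_mfderiv hi z).self_of_nhds, (eventually_chartVec_mfderiv hi z).self_of_nhds,
    hFw, fderiv_clm_apply hDF hA, hV.self_of_nhds]
  simp only [add_apply, ContinuousLinearMap.comp_apply, ContinuousLinearMap.flip_apply]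
  congr 1
  exact add_comm _ _

theorem coordMetric_chartVec
    (g : ContMDiffRiemannianMetric 𝓘(ℝ, E) ∞ E (fun y : M ↦ TangentSpace 𝓘(ℝ, E) y))
    {y₀ y : M} (hy : y ∈ (extChartAt 𝓘(ℝ, E) y₀).source) (v w : TangentSpace 𝓘(ℝ, E) y) :
    coordMetric g y₀ (extChartAt 𝓘(ℝ, E) y₀ y) (chartVec y₀ y v) (chartVec y₀ y w) =
      g.inner y v w := by
  have key : ∀ (y' : M) (a b : E), y' = y → a = coordField y₀ (chartVec y₀ y v) y →
      b = coordField y₀ (chartVec y₀ y w) y → g.inner y' a b = g.inner y v w := by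
    rintro y' _ _ rfl rfl rfl
    rw [coordField_chartVec hy, coordField_chartVec hy]
  exact key _ _ _ ((extChartAt 𝓘(ℝ, E) y₀).left_inv hy) rfl rfl

end Local

/-! ### Components of tangent vectors and lifts on a product -/

section Product

variable {E₁ : Type*} [NormedAddCommGroup E₁] [NormedSpace ℝ E₁]
  {M₁ : Type*} [TopologicalSpace M₁] [ChartedSpace E₁ M₁] [IsManifold 𝓘(ℝ, E₁) ∞ M₁]
  {E₂ : Type*} [NormedAddCommGroup E₂] [NormedSpace ℝ E₂]
  {M₂ : Type*} [TopologicalSpace M₂] [ChartedSpace E₂ M₂] [IsManifold 𝓘(ℝ, E₂) ∞ M₂]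

theorem sourceVec_prod {z x : M₁ × M₂} (h₁ : x.1 ∈ (extChartAt 𝓘(ℝ, E₁) z.1).source)
    (h₂ : x.2 ∈ (extChartAt 𝓘(ℝ, E₂) z.2).source)
    (v : TangentSpace (𝓘(ℝ, E₁).prod 𝓘(ℝ, E₂)) x) :
    sourceVec (𝓘(ℝ, E₁).prod 𝓘(ℝ, E₂)) z x v =
      (chartVec z.1 x.1 (Prod.fst (α := E₁) (β := E₂) v),
        chartVec z.2 x.2 (Prod.snd (α := E₁) (β := E₂) v)) := by
  have : IsManifold 𝓘(ℝ, E₁) 1 M₁ := .of_le (n := ∞) (by norm_cast)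
  have : IsManifold 𝓘(ℝ, E₂) 1 M₂ := .of_le (n := ∞) (by norm_cast)
  have k₁ := mdifferentiableAt_extChartAt (I := 𝓘(ℝ, E₁)) (x := z.1) (y := x.1) (by simpa using h₁)
  have k₂ := mdifferentiableAt_extChartAt (I := 𝓘(ℝ, E₂)) (x := z.2) (y := x.2) (by simpa using h₂)
  have h₁' := k₁.hasMFDerivAt.comp x (hasMFDerivAt_fst (I := 𝓘(ℝ, E₁)) (I' := 𝓘(ℝ, E₂)) x)
  have h₂' := k₂.hasMFDerivAt.comp x (hasMFDerivAt_snd (I := 𝓘(ℝ, E₁)) (I' := 𝓘(ℝ, E₂)) x)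
  have h : HasMFDerivAt (𝓘(ℝ, E₁).prod 𝓘(ℝ, E₂)) 𝓘(ℝ, E₁ × E₂)
      (fun x : M₁ × M₂ ↦ (extChartAt 𝓘(ℝ, E₁) z.1 x.1, extChartAt 𝓘(ℝ, E₂) z.2 x.2)) x _ :=
    ⟨h₁'.1.prodMk h₂'.1, h₁'.2.prodMk h₂'.2⟩
  have he : (extChartAt (𝓘(ℝ, E₁).prod 𝓘(ℝ, E₂)) z : M₁ × M₂ → E₁ × E₂) =
      fun x ↦ (extChartAt 𝓘(ℝ, E₁) z.1 x.1, extChartAt 𝓘(ℝ, E₂) z.2 x.2) := by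
    rw [extChartAt_prod]; rfl
  rw [sourceVec, he]
  exact congr($(h.mfderiv) v)

omit [IsManifold 𝓘(ℝ, E₂) ∞ M₂] in
theorem horizontalLift_eq (X : (x : M₁) → TangentSpace 𝓘(ℝ, E₁) x) (z : M₁ × M₂) :
    horizontalLift 𝓘(ℝ, E₁) 𝓘(ℝ, E₂) X z = ((X z.1, 0) : E₁ × E₂) := by
  have : IsManifold 𝓘(ℝ, E₁) 1 M₁ := .of_le (n := ∞) (by norm_cast)
  rw [horizontalLift, mfderiv_prod_left]
  rfl

omit [IsManifold 𝓘(ℝ, E₁) ∞ M₁] [IsManifold 𝓘(ℝ, E₂) ∞ M₂] in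
theorem verticalLift_eq (Z : (y : M₂) → TangentSpace 𝓘(ℝ, E₂) y) (z : M₁ × M₂) :
    verticalLift 𝓘(ℝ, E₁) 𝓘(ℝ, E₂) Z z = ((0, Z z.2) : E₁ × E₂) := by
  rw [verticalLift, mfderiv_prod_right]
  rfl

end Product

/-! ### Covariant derivatives of lifts on a warped product -/

section WarpedLocal

theorem exists_coord_expression {E : Type*} [NormedAddCommGroup E] [NormedSpace ℝ E]
    {M : Type*} [TopologicalSpace M] [ChartedSpace E M] [IsManifold 𝓘(ℝ, E) ∞ M]
    {X : (x : M) → TangentSpace 𝓘(ℝ, E) x} (hX : IsSmoothVectorField 𝓘(ℝ, E) X) (x₀ : M) :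
    ∃ A : E → E, DifferentiableAt ℝ A (extChartAt 𝓘(ℝ, E) x₀ x₀) ∧
      ∀ x ∈ (extChartAt 𝓘(ℝ, E) x₀).source,
        chartVec x₀ x (X x) = A (extChartAt 𝓘(ℝ, E) x₀ x) := by
  have h1 := contMDiffOn_mfderiv_chart le_rfl x₀ (φ := fun y ↦ y) hX.contMDiffOn (fun y hy ↦ hy)
  have h2 := h1.comp (contMDiffOn_extChartAt_symm x₀)
    (fun u hu ↦ (extChartAt 𝓘(ℝ, E) x₀).map_target hu)
  have h3 := contMDiffOn_iff_contDiffOn.1 h2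
  refine ⟨_, (h3.contDiffAt ((isOpen_extChartAt_target x₀).mem_nhds
    (mem_extChartAt_target x₀))).differentiableAt (by simp), fun x hx ↦ ?_⟩
  exact (congrArg (fun x ↦ chartVec x₀ x (X x)) ((extChartAt 𝓘(ℝ, E) x₀).left_inv hx)).symm

variable {E₁ : Type*} [NormedAddCommGroup E₁] [NormedSpace ℝ E₁]
  {M₁ : Type*} [TopologicalSpace M₁] [ChartedSpace E₁ M₁] [IsManifold 𝓘(ℝ, E₁) ∞ M₁]
  {E₂ : Type*} [NormedAddCommGroup E₂] [NormedSpace ℝ E₂]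
  {M₂ : Type*} [TopologicalSpace M₂] [ChartedSpace E₂ M₂] [IsManifold 𝓘(ℝ, E₂) ∞ M₂]

omit [IsManifold 𝓘(ℝ, E₁) ∞ M₁] [IsManifold 𝓘(ℝ, E₂) ∞ M₂] in
theorem eventually_mem_source_prod (z : M₁ × M₂) :
    ∀ᶠ x in 𝓝 z, x.1 ∈ (extChartAt 𝓘(ℝ, E₁) z.1).source ∧
      x.2 ∈ (extChartAt 𝓘(ℝ, E₂) z.2).source :=
  Filter.Eventually.and
    (continuous_fst.continuousAt.preimage_mem_nhds (extChartAt_source_mem_nhds z.1))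
    (continuous_snd.continuousAt.preimage_mem_nhds (extChartAt_source_mem_nhds z.2))

/-- The tangent vector of a product with given components. -/
def prodVec {x : M₁ × M₂} (a : TangentSpace 𝓘(ℝ, E₁) x.1) (b : TangentSpace 𝓘(ℝ, E₂) x.2) :
    TangentSpace (𝓘(ℝ, E₁).prod 𝓘(ℝ, E₂)) x :=
  ((a, b) : E₁ × E₂)

theorem sourceVec_prodVec {z x : M₁ × M₂}
    (h₁ : x.1 ∈ (extChartAt 𝓘(ℝ, E₁) z.1).source) (h₂ : x.2 ∈ (extChartAt 𝓘(ℝ, E₂) z.2).source)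
    (a : TangentSpace 𝓘(ℝ, E₁) x.1) (b : TangentSpace 𝓘(ℝ, E₂) x.2) :
    sourceVec (𝓘(ℝ, E₁).prod 𝓘(ℝ, E₂)) z x (prodVec a b) =
      (chartVec z.1 x.1 a, chartVec z.2 x.2 b) :=
  sourceVec_prod h₁ h₂ _

omit [IsManifold 𝓘(ℝ, E₁) ∞ M₁] [IsManifold 𝓘(ℝ, E₂) ∞ M₂] in
theorem mfderiv_fst_prodVec {x : M₁ × M₂} (a : TangentSpace 𝓘(ℝ, E₁) x.1)
    (b : TangentSpace 𝓘(ℝ, E₂) x.2) :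
    mfderiv (𝓘(ℝ, E₁).prod 𝓘(ℝ, E₂)) 𝓘(ℝ, E₁) Prod.fst x (prodVec a b) = a := by
  rw [mfderiv_fst]; rfl

omit [IsManifold 𝓘(ℝ, E₁) ∞ M₁] [IsManifold 𝓘(ℝ, E₂) ∞ M₂] in
theorem mfderiv_snd_prodVec {x : M₁ × M₂} (a : TangentSpace 𝓘(ℝ, E₁) x.1)
    (b : TangentSpace 𝓘(ℝ, E₂) x.2) :
    mfderiv (𝓘(ℝ, E₁).prod 𝓘(ℝ, E₂)) 𝓘(ℝ, E₂) Prod.snd x (prodVec a b) = b := by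
  rw [mfderiv_snd]; rfl

theorem sourceVec_horizontalLift {z x : M₁ × M₂}
    (h₁ : x.1 ∈ (extChartAt 𝓘(ℝ, E₁) z.1).source) (h₂ : x.2 ∈ (extChartAt 𝓘(ℝ, E₂) z.2).source)
    (X : (x : M₁) → TangentSpace 𝓘(ℝ, E₁) x) :
    sourceVec (𝓘(ℝ, E₁).prod 𝓘(ℝ, E₂)) z x (horizontalLift 𝓘(ℝ, E₁) 𝓘(ℝ, E₂) X x) =
      (chartVec z.1 x.1 (X x.1), 0) := by
  rw [sourceVec_prod h₁ h₂, horizontalLift_eq]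
  exact congrArg (Prod.mk _) (map_zero (chartVec z.2 x.2))

theorem sourceVec_verticalLift {z x : M₁ × M₂}
    (h₁ : x.1 ∈ (extChartAt 𝓘(ℝ, E₁) z.1).source) (h₂ : x.2 ∈ (extChartAt 𝓘(ℝ, E₂) z.2).source)
    (Z : (y : M₂) → TangentSpace 𝓘(ℝ, E₂) y) :
    sourceVec (𝓘(ℝ, E₁).prod 𝓘(ℝ, E₂)) z x (verticalLift 𝓘(ℝ, E₁) 𝓘(ℝ, E₂) Z x) =
      (0, chartVec z.2 x.2 (Z x.2)) := by
  rw [sourceVec_prod h₁ h₂, verticalLift_eq]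
  exact congrArg (fun a ↦ (a, _)) (map_zero (chartVec z.1 x.1))

/-- The components of a horizontal lift depend only on the first coordinate. Together with the
vertical analogue, the vanishing derivative is the coordinate form of `[X, Z] = 0`. -/
theorem exists_coord_horizontalLift {X : (x : M₁) → TangentSpace 𝓘(ℝ, E₁) x}
    (hX : IsSmoothVectorField 𝓘(ℝ, E₁) X) (z : M₁ × M₂) :
    ∃ A : E₁ × E₂ → E₁ × E₂,
      DifferentiableAt ℝ A (extChartAt (𝓘(ℝ, E₁).prod 𝓘(ℝ, E₂)) z z) ∧
      (∀ b : E₂, fderiv ℝ A (extChartAt (𝓘(ℝ, E₁).prod 𝓘(ℝ, E₂)) z z) (0, b) = 0) ∧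
      ∀ᶠ x in 𝓝 z, sourceVec (𝓘(ℝ, E₁).prod 𝓘(ℝ, E₂)) z x
        (horizontalLift 𝓘(ℝ, E₁) 𝓘(ℝ, E₂) X x) =
          A (extChartAt (𝓘(ℝ, E₁).prod 𝓘(ℝ, E₂)) z x) := by
  obtain ⟨A, hA, hAX⟩ := exists_coord_expression hX z.1
  have hw : (extChartAt (𝓘(ℝ, E₁).prod 𝓘(ℝ, E₂)) z z).1 = extChartAt 𝓘(ℝ, E₁) z.1 z.1 := by
    rw [extChartAt_prod]; rfl
  rw [← hw] at hA
  have h := (hA.hasFDerivAt.comp _ hasFDerivAt_fst).prodMk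
    (hasFDerivAt_const (0 : E₂) (extChartAt (𝓘(ℝ, E₁).prod 𝓘(ℝ, E₂)) z z))
  refine ⟨fun w ↦ (A w.1, 0), h.differentiableAt, fun b ↦ ?_, ?_⟩
  · have h' := congr($(h.fderiv) ((0 : E₁), b))
    exact h'.trans (Prod.ext (by simp) (by simp))
  · filter_upwards [eventually_mem_source_prod (E₁ := E₁) (E₂ := E₂) z] with x hx
    rw [sourceVec_horizontalLift hx.1 hx.2, hAX _ hx.1, extChartAt_prod]
    rfl

theorem exists_coord_verticalLift {Z : (y : M₂) → TangentSpace 𝓘(ℝ, E₂) y}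
    (hZ : IsSmoothVectorField 𝓘(ℝ, E₂) Z) (z : M₁ × M₂) :
    ∃ A : E₁ × E₂ → E₁ × E₂,
      DifferentiableAt ℝ A (extChartAt (𝓘(ℝ, E₁).prod 𝓘(ℝ, E₂)) z z) ∧
      (∀ a : E₁, fderiv ℝ A (extChartAt (𝓘(ℝ, E₁).prod 𝓘(ℝ, E₂)) z z) (a, 0) = 0) ∧
      ∀ᶠ x in 𝓝 z, sourceVec (𝓘(ℝ, E₁).prod 𝓘(ℝ, E₂)) z x
        (verticalLift 𝓘(ℝ, E₁) 𝓘(ℝ, E₂) Z x) =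
          A (extChartAt (𝓘(ℝ, E₁).prod 𝓘(ℝ, E₂)) z x) := by
  obtain ⟨A, hA, hAZ⟩ := exists_coord_expression hZ z.2
  have hw : (extChartAt (𝓘(ℝ, E₁).prod 𝓘(ℝ, E₂)) z z).2 = extChartAt 𝓘(ℝ, E₂) z.2 z.2 := by
    rw [extChartAt_prod]; rfl
  rw [← hw] at hA
  have h := (hasFDerivAt_const (0 : E₁) (extChartAt (𝓘(ℝ, E₁).prod 𝓘(ℝ, E₂)) z z)).prodMk
    (hA.hasFDerivAt.comp _ hasFDerivAt_snd)
  refine ⟨fun w ↦ (0, A w.2), h.differentiableAt, fun a ↦ ?_, ?_⟩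
  · have h' := congr($(h.fderiv) (a, (0 : E₂)))
    exact h'.trans (Prod.ext (by simp) (by simp))
  · filter_upwards [eventually_mem_source_prod (E₁ := E₁) (E₂ := E₂) z] with x hx
    rw [sourceVec_verticalLift hx.1 hx.2, hAZ _ hx.2, extChartAt_prod]
    rfl

variable {E : Type*} [NormedAddCommGroup E] [NormedSpace ℝ E] [FiniteDimensional ℝ E]
  {M : Type*} [TopologicalSpace M] [ChartedSpace E M] [IsManifold 𝓘(ℝ, E) ∞ M]
  {g₁ : ContMDiffRiemannianMetric 𝓘(ℝ, E₁) ∞ E₁ (fun x : M₁ ↦ TangentSpace 𝓘(ℝ, E₁) x)}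
  {g₂ : ContMDiffRiemannianMetric 𝓘(ℝ, E₂) ∞ E₂ (fun y : M₂ ↦ TangentSpace 𝓘(ℝ, E₂) y)}
  {f : M₁ → ℝ}
  {g : ContMDiffRiemannianMetric 𝓘(ℝ, E) ∞ E (fun y : M ↦ TangentSpace 𝓘(ℝ, E) y)}
  {i : M₁ × M₂ → M}

/-- The covariant derivatives `∇̄_Z X` and `∇̄_X Z` of lifts agree. -/
theorem covDerivAlong_lift_comm (hi : ContMDiff (𝓘(ℝ, E₁).prod 𝓘(ℝ, E₂)) 𝓘(ℝ, E) ∞ i)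
    {X : (x : M₁) → TangentSpace 𝓘(ℝ, E₁) x} {Z : (y : M₂) → TangentSpace 𝓘(ℝ, E₂) y}
    (hX : IsSmoothVectorField 𝓘(ℝ, E₁) X) (hZ : IsSmoothVectorField 𝓘(ℝ, E₂) Z) (z : M₁ × M₂) :
    covDerivAlong (𝓘(ℝ, E₁).prod 𝓘(ℝ, E₂)) g i
      (fun x ↦ mfderiv (𝓘(ℝ, E₁).prod 𝓘(ℝ, E₂)) 𝓘(ℝ, E) i x
        (verticalLift 𝓘(ℝ, E₁) 𝓘(ℝ, E₂) Z x)) z (horizontalLift 𝓘(ℝ, E₁) 𝓘(ℝ, E₂) X z) =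
    covDerivAlong (𝓘(ℝ, E₁).prod 𝓘(ℝ, E₂)) g i
      (fun x ↦ mfderiv (𝓘(ℝ, E₁).prod 𝓘(ℝ, E₂)) 𝓘(ℝ, E) i x
        (horizontalLift 𝓘(ℝ, E₁) 𝓘(ℝ, E₂) X x)) z (verticalLift 𝓘(ℝ, E₁) 𝓘(ℝ, E₂) Z z) := by
  obtain ⟨A, hA, hA0, hAX⟩ := exists_coord_horizontalLift (E₂ := E₂) hX z
  obtain ⟨B, hB, hB0, hBZ⟩ := exists_coord_verticalLift (E₁ := E₁) hZ z
  have hz := (eventually_mem_source_prod (E₁ := E₁) (E₂ := E₂) z).self_of_nhds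
  have hs : IsSymmSndFDerivAt ℝ (writtenInExtChartAt (𝓘(ℝ, E₁).prod 𝓘(ℝ, E₂)) 𝓘(ℝ, E) z i)
      (extChartAt (𝓘(ℝ, E₁).prod 𝓘(ℝ, E₂)) z z) :=
    (contDiffAt_writtenInExtChartAt (hi z)).isSymmSndFDerivAt (by simp; norm_cast)
  have hFw : writtenInExtChartAt (𝓘(ℝ, E₁).prod 𝓘(ℝ, E₂)) 𝓘(ℝ, E) z i
      (extChartAt (𝓘(ℝ, E₁).prod 𝓘(ℝ, E₂)) z z) = extChartAt 𝓘(ℝ, E) (i z) (i z) := by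
    simp only [writtenInExtChartAt, Function.comp_apply, extChartAt_to_inv]
  apply chartVec_injective (mem_extChartAt_source (i z))
  rw [chartVec_covDerivAlong_mfderiv g hi hA hAX, chartVec_covDerivAlong_mfderiv g hi hB hBZ]
  rw [sourceVec_horizontalLift hz.1 hz.2, sourceVec_verticalLift hz.1 hz.2]
  simp only [map_zero, hA0, hB0]
  -- Only the second derivative of the local expression and the Christoffel term remain, and both
  -- are symmetric.
  rw [hs.eq, hFw, christoffel_symm g (mem_extChartAt_target (i z))]

omit [FiniteDimensional ℝ E] in
-- The isometry condition in coordinates. It is needed on a whole neighbourhood, since Koszul's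
-- formula differentiates it.
theorem IsWarpedProductSubmanifold.eventually_coordMetric
    (hi : IsWarpedProductSubmanifold g₁ g₂ f g i) (z : M₁ × M₂) :
    let F := writtenInExtChartAt (𝓘(ℝ, E₁).prod 𝓘(ℝ, E₂)) 𝓘(ℝ, E) z i
    ∀ᶠ w in 𝓝 (extChartAt (𝓘(ℝ, E₁).prod 𝓘(ℝ, E₂)) z z), ∀ α β : E₁ × E₂,
      coordMetric g (i z) (F w) (fderiv ℝ F w α) (fderiv ℝ F w β) =
        coordMetric g₁ z.1 w.1 α.1 β.1 +
          f ((extChartAt 𝓘(ℝ, E₁) z.1).symm w.1) ^ 2 * coordMetric g₂ z.2 w.2 α.2 β.2 := by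
  intro F
  set e := extChartAt (𝓘(ℝ, E₁).prod 𝓘(ℝ, E₂)) z with he
  have hs : ∀ᶠ x in 𝓝 z, i x ∈ (extChartAt 𝓘(ℝ, E) (i z)).source :=
    (hi.smooth z).continuousAt.preimage_mem_nhds (extChartAt_source_mem_nhds (i z))
  have h := ((eventually_chartVec_mfderiv hi.smooth z).and hs).and
    (eventually_mem_source_prod (E₁ := E₁) (E₂ := E₂) z)
  have ht : Filter.Tendsto e.symm (𝓝 (e z)) (𝓝 z) := by
    have := continuousAt_extChartAt_symm (I := 𝓘(ℝ, E₁).prod 𝓘(ℝ, E₂)) z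
    rwa [ContinuousAt, extChartAt_to_inv] at this
  filter_upwards [ht.eventually h, extChartAt_target_mem_nhds (I := 𝓘(ℝ, E₁).prod 𝓘(ℝ, E₂)) z]
    with w hw hwt α β
  obtain ⟨x, hx⟩ : ∃ x, x = e.symm w := ⟨_, rfl⟩
  have hxw : w = e x := by rw [hx, e.right_inv hwt]
  rw [← hx] at hw
  obtain ⟨⟨hd, hsx⟩, h1, h2⟩ := hw
  -- Coordinate fields of the two factors realize any prescribed components `γ` at `x`.
  have hvec : ∀ γ : E₁ × E₂, sourceVec (𝓘(ℝ, E₁).prod 𝓘(ℝ, E₂)) z x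
      (prodVec (coordField z.1 γ.1 x.1) (coordField z.2 γ.2 x.2)) = γ := fun γ ↦ by
    rw [sourceVec_prodVec h1 h2, chartVec_coordField h1, chartVec_coordField h2]
  have hw1 : w.1 = extChartAt 𝓘(ℝ, E₁) z.1 x.1 := by rw [hxw, he, extChartAt_prod]; rfl
  have hw2 : w.2 = extChartAt 𝓘(ℝ, E₂) z.2 x.2 := by rw [hxw, he, extChartAt_prod]; rfl
  have hFw : F w = extChartAt 𝓘(ℝ, E) (i z) (i x) := by
    simp only [F, writtenInExtChartAt, Function.comp_apply, ← he, ← hx]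
  have hDF : ∀ γ, fderiv ℝ F w γ = chartVec (i z) (i x)
      (mfderiv (𝓘(ℝ, E₁).prod 𝓘(ℝ, E₂)) 𝓘(ℝ, E) i x
        (prodVec (coordField z.1 γ.1 x.1) (coordField z.2 γ.2 x.2))) := fun γ ↦ by
    rw [hd, hvec, ← hxw]
  rw [hDF, hDF, hFw, coordMetric_chartVec g hsx, hi.isometric, warpedMetric,
    mfderiv_fst_prodVec, mfderiv_fst_prodVec, mfderiv_snd_prodVec, mfderiv_snd_prodVec, hw1, hw2,
    (extChartAt 𝓘(ℝ, E₁) z.1).left_inv h1]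
  have k₁ := coordMetric_chartVec g₁ h1 (coordField z.1 α.1 x.1) (coordField z.1 β.1 x.1)
  have k₂ := coordMetric_chartVec g₂ h2 (coordField z.2 α.2 x.2) (coordField z.2 β.2 x.2)
  rw [chartVec_coordField h1, chartVec_coordField h1] at k₁
  rw [chartVec_coordField h2, chartVec_coordField h2] at k₂
  rw [k₁, k₂]

/-- The tangential part of `∇̄_Z X` is `(X f / f) Z`. -/
theorem IsWarpedProductSubmanifold.inner_covDerivAlong
    [FiniteDimensional ℝ E₁] [FiniteDimensional ℝ E₂]
    (hi : IsWarpedProductSubmanifold g₁ g₂ f g i)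
    {X : (x : M₁) → TangentSpace 𝓘(ℝ, E₁) x} {Z : (y : M₂) → TangentSpace 𝓘(ℝ, E₂) y}
    (hX : IsSmoothVectorField 𝓘(ℝ, E₁) X) (z : M₁ × M₂)
    (γ : TangentSpace (𝓘(ℝ, E₁).prod 𝓘(ℝ, E₂)) z) :
    g.inner (i z) (covDerivAlong (𝓘(ℝ, E₁).prod 𝓘(ℝ, E₂)) g i
      (fun x ↦ mfderiv (𝓘(ℝ, E₁).prod 𝓘(ℝ, E₂)) 𝓘(ℝ, E) i x
        (horizontalLift 𝓘(ℝ, E₁) 𝓘(ℝ, E₂) X x)) z (verticalLift 𝓘(ℝ, E₁) 𝓘(ℝ, E₂) Z z))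
      (mfderiv (𝓘(ℝ, E₁).prod 𝓘(ℝ, E₂)) 𝓘(ℝ, E) i z γ) =
    f z.1 * vderiv 𝓘(ℝ, E₁) f z.1 (X z.1) *
      g₂.inner z.2 (Z z.2) (Prod.snd (α := E₁) (β := E₂) γ) := by
  obtain ⟨A, hA, hA0, hAX⟩ := exists_coord_horizontalLift (E₂ := E₂) hX z
  have hz := (eventually_mem_source_prod (E₁ := E₁) (E₂ := E₂) z).self_of_nhds
  have hzi := mem_extChartAt_source (I := 𝓘(ℝ, E)) (i z)
  set F := writtenInExtChartAt (𝓘(ℝ, E₁).prod 𝓘(ℝ, E₂)) 𝓘(ℝ, E) z i with hF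
  set w := extChartAt (𝓘(ℝ, E₁).prod 𝓘(ℝ, E₂)) z z with hw
  have hFw : F w = extChartAt 𝓘(ℝ, E) (i z) (i z) := by
    simp only [hF, hw, writtenInExtChartAt, Function.comp_apply, extChartAt_to_inv]
  have hw1 : w.1 = extChartAt 𝓘(ℝ, E₁) z.1 z.1 := by rw [hw, extChartAt_prod]; rfl
  have hw2 : w.2 = extChartAt 𝓘(ℝ, E₂) z.2 z.2 := by rw [hw, extChartAt_prod]; rfl
  have htg : F w ∈ (extChartAt 𝓘(ℝ, E) (i z)).target := hFw ▸ mem_extChartAt_target (i z)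
  have ht1 : w.1 ∈ (extChartAt 𝓘(ℝ, E₁) z.1).target := hw1 ▸ mem_extChartAt_target z.1
  have ht2 : w.2 ∈ (extChartAt 𝓘(ℝ, E₂) z.2).target := hw2 ▸ mem_extChartAt_target z.2
  have hfd : DifferentiableAt ℝ (writtenInExtChartAt 𝓘(ℝ, E₁) 𝓘(ℝ, ℝ) z.1 f) w.1 :=
    hw1 ▸ (contDiffAt_writtenInExtChartAt (hi.warping_smooth z.1)).differentiableAt (by simp)
  have hfX : fderiv ℝ (writtenInExtChartAt 𝓘(ℝ, E₁) 𝓘(ℝ, ℝ) z.1 f) w.1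
      (chartVec z.1 z.1 (X z.1)) = vderiv 𝓘(ℝ, E₁) f z.1 (X z.1) := by
    have : IsManifold 𝓘(ℝ, E₁) 1 M₁ := .of_le (n := ∞) (by norm_cast)
    rw [hw1] at hfd ⊢
    refine (vderiv_of_eventuallyEq_chart (mem_extChartAt_source z.1) hfd ?_ (X z.1)).symm
    filter_upwards [extChartAt_source_mem_nhds (I := 𝓘(ℝ, E₁)) z.1] with x hx
    simp only [writtenInExtChartAt, Function.comp_apply, (extChartAt 𝓘(ℝ, E₁) z.1).left_inv hx]
    rfl
  have hk := koszul_warped ((contDiffAt_writtenInExtChartAt (hi.smooth z)).of_le (by norm_cast))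
    (differentiableAt_coordMetric g htg) (coordMetric_symm g _ _)
    (differentiableAt_coordMetric g₁ ht1) (differentiableAt_coordMetric g₂ ht2) hfd
    (hi.eventually_coordMetric z) (chartVec z.1 z.1 (X z.1)) (chartVec z.2 z.2 (Z z.2))
    (sourceVec (𝓘(ℝ, E₁).prod 𝓘(ℝ, E₂)) z z γ)
  -- The three derivatives of the ambient metric in `koszul_warped` are exactly twice the ambient
  -- Christoffel term in the coordinate formula for `∇̄_Z X`.
  rw [← coordMetric_christoffel g htg, hfX] at hk
  rw [← coordMetric_chartVec g hzi, chartVec_covDerivAlong_mfderiv g hi.smooth hA hAX,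
    (eventually_chartVec_mfderiv hi.smooth z).self_of_nhds, ← hFw,
    sourceVec_horizontalLift hz.1 hz.2, sourceVec_verticalLift hz.1 hz.2]
  simp only [map_zero, hA0, ← hF, ← hw, add_zero, map_add, add_apply]
  have hg₂ : coordMetric g₂ z.2 w.2 (chartVec z.2 z.2 (Z z.2))
      (sourceVec (𝓘(ℝ, E₁).prod 𝓘(ℝ, E₂)) z z γ).2 =
      g₂.inner z.2 (Z z.2) (Prod.snd (α := E₁) (β := E₂) γ) := by
    rw [sourceVec_prod hz.1 hz.2, hw2]
    exact coordMetric_chartVec g₂ hz.2 _ _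
  have hfw : writtenInExtChartAt 𝓘(ℝ, E₁) 𝓘(ℝ, ℝ) z.1 f w.1 = f z.1 := by
    rw [hw1, writtenInExtChartAt, Function.comp_apply, Function.comp_apply, extChartAt_to_inv]
    rfl
  rw [hg₂, hfw] at hk
  linarith

end WarpedLocal

/-! ### Vanishing differential and constancy on components -/

section LocallyConstant

variable {E : Type*} [NormedAddCommGroup E] [NormedSpace ℝ E]
  {M : Type*} [TopologicalSpace M] [ChartedSpace E M] [IsManifold 𝓘(ℝ, E) ∞ M]

/-- A manifold is locally connected, so components are open and constancy on them kills the
differential. Conversely, a zero differential makes `f` constant on balls of a chart, as these are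
convex, hence locally constant, hence constant on preconnected sets. -/
theorem vderiv_eq_zero_iff_const_on_components {f : M → ℝ} (hf : ContMDiff 𝓘(ℝ, E) 𝓘(ℝ, ℝ) ∞ f) :
    (∀ x x' : M, x' ∈ connectedComponent x → f x' = f x) ↔
      ∀ (x : M) (v : TangentSpace 𝓘(ℝ, E) x), vderiv 𝓘(ℝ, E) f x v = 0 := by
  have : IsManifold 𝓘(ℝ, E) 1 M := .of_le (n := ∞) (by norm_cast)
  have : LocallyConnectedSpace M := ChartedSpace.locallyConnectedSpace E M
  refine ⟨fun h x v ↦ ?_, fun h x x' hx' ↦ ?_⟩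
  · have hev : f =ᶠ[𝓝 x] fun _ ↦ f x := by
      filter_upwards [isOpen_connectedComponent.mem_nhds (mem_connectedComponent (x := x))]
        with x' hx' using h x x' hx'
    have h0 := hev.mfderiv_eq (I := 𝓘(ℝ, E)) (I' := 𝓘(ℝ, ℝ))
    rw [mfderiv_const] at h0
    exact congr($h0 v)
  · have hloc : IsLocallyConstant f := by
      rw [IsLocallyConstant.iff_eventually_eq]
      intro x
      set e := extChartAt 𝓘(ℝ, E) x
      obtain ⟨r, hr, hball⟩ := Metric.mem_nhds_iff.1 (extChartAt_target_mem_nhds (I := 𝓘(ℝ, E)) x)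
      have hd : ∀ u ∈ Metric.ball (e x) r, HasFDerivAt (f ∘ e.symm) (0 : E →L[ℝ] ℝ) u := by
        intro u hu
        have hs := (contMDiffOn_extChartAt_symm (I := 𝓘(ℝ, E)) (n := ∞) x).contMDiffAt
          ((isOpen_extChartAt_target x).mem_nhds (hball hu))
        have hm := ((hf (e.symm u)).mdifferentiableAt (by simp)).hasMFDerivAt.comp u
          (hs.mdifferentiableAt (by simp)).hasMFDerivAt
        have h0 : mfderiv 𝓘(ℝ, E) 𝓘(ℝ, ℝ) f (e.symm u) = 0 := by
          ext v
          exact h _ v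
        rw [h0, ContinuousLinearMap.zero_comp] at hm
        exact hm.hasFDerivAt
      have hc : ∀ u ∈ Metric.ball (e x) r, f (e.symm u) = f (e.symm (e x)) := fun u hu ↦
        (convex_ball (e x) r).is_const_of_fderivWithin_eq_zero (𝕜 := ℝ) (f := f ∘ e.symm)
          (fun u hu ↦ (hd u hu).differentiableAt.differentiableWithinAt)
          (fun u hu ↦ by
            rw [fderivWithin_of_isOpen Metric.isOpen_ball hu, (hd u hu).fderiv])
          hu (Metric.mem_ball_self hr)
      filter_upwards [(continuousAt_extChartAt (I := 𝓘(ℝ, E)) x).preimage_mem_nhds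
        (Metric.ball_mem_nhds _ hr), extChartAt_source_mem_nhds (I := 𝓘(ℝ, E)) x] with x' h1 h2
      have h3 := hc _ h1
      rwa [e.left_inv h2, e.left_inv (mem_extChartAt_source x)] at h3
    exact hloc.apply_eq_of_isPreconnected isPreconnected_connectedComponent hx'
      mem_connectedComponent

end LocallyConstant

/-! ### Tangential and normal projections, and the algebra of `J` -/

section Projections

variable {E : Type*} [NormedAddCommGroup E] [NormedSpace ℝ E] [FiniteDimensional ℝ E]
  {H : Type*} [TopologicalSpace H] {I : ModelWithCorners ℝ E H}
  {M : Type*} [TopologicalSpace M] [ChartedSpace H M] [IsManifold I ∞ M]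
  {E' : Type*} [NormedAddCommGroup E'] [NormedSpace ℝ E']
  {H' : Type*} [TopologicalSpace H'] {I' : ModelWithCorners ℝ E' H'}
  {N : Type*} [TopologicalSpace N] [ChartedSpace H' N]
  {g : ContMDiffRiemannianMetric I ∞ E (fun y : M ↦ TangentSpace I y)}
  {φ : N → M} {x : N}

theorem tangentPart_eq_zero_iff {v : TangentSpace I (φ x)} :
    tangentPart I' g φ x v = 0 ↔ v ∈ normalAt I' g φ x :=
  Submodule.projection_apply_eq_zero_iff _

theorem tangentPart_eq_zero_iff_inner {v : TangentSpace I (φ x)} :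
    tangentPart I' g φ x v = 0 ↔
      ∀ γ : TangentSpace I' x, g.inner (φ x) v (mfderiv I' I φ x γ) = 0 := by
  rw [tangentPart_eq_zero_iff, normalAt, LinearMap.BilinForm.mem_orthogonal_iff]
  refine ⟨fun h γ ↦ ?_, ?_⟩
  · rw [g.symm]
    exact h _ ⟨γ, rfl⟩
  · rintro h _ ⟨γ, rfl⟩
    exact (g.symm _ _ _).trans (h γ)

theorem normalPart_of_mem {v : TangentSpace I (φ x)} (hv : v ∈ normalAt I' g φ x) :
    normalPart I' g φ x v = v :=
  Submodule.projection_apply_left _ ⟨v, hv⟩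

theorem tangentPart_mem (v : TangentSpace I (φ x)) :
    tangentPart I' g φ x v ∈ tangentAt (I := I) I' φ x :=
  Submodule.projection_apply_mem _ v

theorem normalPart_eq_sub (v : TangentSpace I (φ x)) :
    normalPart I' g φ x v = v - tangentPart I' g φ x v :=
  eq_sub_of_add_eq' (Submodule.projection_add_projection_eq_self _ v)

/-- If `J` maps tangent vectors to normal vectors and `J² = pJ + qI`, then
`t((J D)^⊥) = p t(D^⊥) + q Dᵀ`. -/
theorem opt_normalPart_apply_eq_iff {p q : ℕ} (hq : 0 < q)
    {J : (y : M) → TangentSpace I y →L[ℝ] TangentSpace I y} (hJ : IsMetallicRiemannian p q g J)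
    (h : ∀ v : TangentSpace I' x, J (φ x) (mfderiv I' I φ x v) ∈ normalAt I' g φ x)
    (D : TangentSpace I (φ x)) :
    opt I' g J φ x (normalPart I' g φ x (J (φ x) D)) =
        (p : ℝ) • opt I' g J φ x (normalPart I' g φ x D) ↔
      tangentPart I' g φ x D = 0 := by
  have h0 : ∀ v, tangentPart I' g φ x (J (φ x) (tangentPart I' g φ x v)) = 0 := fun v ↦ by
    obtain ⟨w, hw⟩ := tangentPart_mem (I' := I') (g := g) (φ := φ) v
    rw [← hw]
    exact tangentPart_eq_zero_iff.2 (h w)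
  -- Passing from `v` to `v^⊥` changes `J v` by `J` of a tangent vector, which is normal and is
  -- killed by the tangential projection.
  have h1 : ∀ v, opt I' g J φ x (normalPart I' g φ x v) = tangentPart I' g φ x (J (φ x) v) :=
    fun v ↦ by rw [opt, normalPart_eq_sub, map_sub, map_sub, h0, sub_zero]
  -- The common term `p (J D)ᵀ` cancels and leaves `q Dᵀ = 0`.
  rw [h1, h1, hJ.sq, map_add, map_smul, map_smul, add_eq_left, smul_eq_zero]
  simp [hq.ne']

end Projections

/-! ### The pointwise equivalence and the theorem -/

section Main

variable {E₁ : Type*} [NormedAddCommGroup E₁] [NormedSpace ℝ E₁] [FiniteDimensional ℝ E₁]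
  {M₁ : Type*} [TopologicalSpace M₁] [ChartedSpace E₁ M₁] [IsManifold 𝓘(ℝ, E₁) ∞ M₁]
  {E₂ : Type*} [NormedAddCommGroup E₂] [NormedSpace ℝ E₂] [FiniteDimensional ℝ E₂]
  {M₂ : Type*} [TopologicalSpace M₂] [ChartedSpace E₂ M₂] [IsManifold 𝓘(ℝ, E₂) ∞ M₂]
  {E : Type*} [NormedAddCommGroup E] [NormedSpace ℝ E] [FiniteDimensional ℝ E]
  {M : Type*} [TopologicalSpace M] [T2Space M] [ChartedSpace E M] [IsManifold 𝓘(ℝ, E) ∞ M]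
  {g₁ : ContMDiffRiemannianMetric 𝓘(ℝ, E₁) ∞ E₁ (fun x : M₁ ↦ TangentSpace 𝓘(ℝ, E₁) x)}
  {g₂ : ContMDiffRiemannianMetric 𝓘(ℝ, E₂) ∞ E₂ (fun y : M₂ ↦ TangentSpace 𝓘(ℝ, E₂) y)}
  {f : M₁ → ℝ}
  {g : ContMDiffRiemannianMetric 𝓘(ℝ, E) ∞ E (fun y : M ↦ TangentSpace 𝓘(ℝ, E) y)}
  {J : (y : M) → TangentSpace 𝓘(ℝ, E) y →L[ℝ] TangentSpace 𝓘(ℝ, E) y}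
  {i : M₁ × M₂ → M} {p q : ℕ}

omit [FiniteDimensional ℝ E₁] [FiniteDimensional ℝ E₂] [FiniteDimensional ℝ E] [T2Space M] in
theorem antiInvariant_of_factors (h₁ : FstAntiInvariant 𝓘(ℝ, E₁) 𝓘(ℝ, E₂) g J i)
    (h₂ : SndAntiInvariant 𝓘(ℝ, E₁) 𝓘(ℝ, E₂) g J i) (z : M₁ × M₂)
    (v : TangentSpace (𝓘(ℝ, E₁).prod 𝓘(ℝ, E₂)) z) :
    J (i z) (mfderiv (𝓘(ℝ, E₁).prod 𝓘(ℝ, E₂)) 𝓘(ℝ, E) i z v) ∈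
      normalAt (𝓘(ℝ, E₁).prod 𝓘(ℝ, E₂)) g i z := by
  have hv : v = prodVec (Prod.fst (α := E₁) (β := E₂) v) 0 +
      prodVec 0 (Prod.snd (α := E₁) (β := E₂) v) :=
    Prod.ext (add_zero (Prod.fst (α := E₁) (β := E₂) v)).symm
      (zero_add (Prod.snd (α := E₁) (β := E₂) v)).symm
  rw [hv, map_add, map_add]
  exact add_mem (h₁ z _ (mfderiv_snd_prodVec _ _)) (h₂ z _ (mfderiv_fst_prodVec _ _))

/-- The pointwise content of the identity `t ∇^⊥_Z N X = p t h(X, Z)`. -/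
theorem opt_normalConnection_eq_iff (hq : 0 < q) (hJ : IsLocallyMetallicRiemannian p q g J)
    (hi : IsWarpedProductSubmanifold g₁ g₂ f g i)
    (h₁ : FstAntiInvariant 𝓘(ℝ, E₁) 𝓘(ℝ, E₂) g J i)
    (h₂ : SndAntiInvariant 𝓘(ℝ, E₁) 𝓘(ℝ, E₂) g J i)
    {X : (x : M₁) → TangentSpace 𝓘(ℝ, E₁) x} {Z : (y : M₂) → TangentSpace 𝓘(ℝ, E₂) y}
    (hX : IsSmoothVectorField 𝓘(ℝ, E₁) X) (hZ : IsSmoothVectorField 𝓘(ℝ, E₂) Z) (z : M₁ × M₂) :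
    opt (𝓘(ℝ, E₁).prod 𝓘(ℝ, E₂)) g J i z
        (normalConnection (𝓘(ℝ, E₁).prod 𝓘(ℝ, E₂)) g i
          (opN (𝓘(ℝ, E₁).prod 𝓘(ℝ, E₂)) g J i (horizontalLift 𝓘(ℝ, E₁) 𝓘(ℝ, E₂) X)) z
          (verticalLift 𝓘(ℝ, E₁) 𝓘(ℝ, E₂) Z z)) =
      (p : ℝ) • opt (𝓘(ℝ, E₁).prod 𝓘(ℝ, E₂)) g J i z
        (secondFundamentalForm (𝓘(ℝ, E₁).prod 𝓘(ℝ, E₂)) g i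
          (horizontalLift 𝓘(ℝ, E₁) 𝓘(ℝ, E₂) X) (verticalLift 𝓘(ℝ, E₁) 𝓘(ℝ, E₂) Z) z) ↔
    ∀ γ : TangentSpace (𝓘(ℝ, E₁).prod 𝓘(ℝ, E₂)) z,
      f z.1 * vderiv 𝓘(ℝ, E₁) f z.1 (X z.1) *
        g₂.inner z.2 (Z z.2) (Prod.snd (α := E₁) (β := E₂) γ) = 0 := by
  have hanti := antiInvariant_of_factors h₁ h₂
  -- An equality of fields, not just of values at `z`, because `NX` is about to be differentiated.
  have hN : opN (𝓘(ℝ, E₁).prod 𝓘(ℝ, E₂)) g J i (horizontalLift 𝓘(ℝ, E₁) 𝓘(ℝ, E₂) X) =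
      fun x ↦ J (i x) (mfderiv (𝓘(ℝ, E₁).prod 𝓘(ℝ, E₂)) 𝓘(ℝ, E) i x
        (horizontalLift 𝓘(ℝ, E₁) 𝓘(ℝ, E₂) X x)) :=
    funext fun x ↦ normalPart_of_mem (hanti x _)
  obtain ⟨A, hA, -, hAX⟩ := exists_coord_horizontalLift (E₂ := E₂) hX z
  -- The second fundamental form differentiates `Z` along `X`; exchanging the two makes both sides
  -- expressions in the single vector `∇̄_Z X`.
  rw [normalConnection, secondFundamentalForm, hN, covDerivAlong_lift_comm hi.smooth hX hZ,
    hJ.covDerivAlong_apply ((hi.smooth z).mdifferentiableAt (by simp))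
      (mdifferentiableAt_compAlong hi.smooth hA hAX),
    opt_normalPart_apply_eq_iff hq hJ.toIsMetallicRiemannian (hanti z),
    tangentPart_eq_zero_iff_inner]
  exact forall_congr' fun γ ↦ by rw [hi.inner_covDerivAlong hX]

end Main

end MetallicWarped

theorem propositionp4 {n₁ n₂ m : ℕ} (hn₁ : 0 < n₁) (hn₂ : 0 < n₂)
    {M₁ : Type*} [TopologicalSpace M₁] [T2Space M₁]
    [ChartedSpace (EuclideanSpace ℝ (Fin n₁)) M₁] [IsManifold (𝓡 n₁) ∞ M₁]
    {M₂ : Type*} [TopologicalSpace M₂] [T2Space M₂] [Nonempty M₂]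
    [ChartedSpace (EuclideanSpace ℝ (Fin n₂)) M₂] [IsManifold (𝓡 n₂) ∞ M₂]
    {M : Type*} [TopologicalSpace M] [T2Space M]
    [ChartedSpace (EuclideanSpace ℝ (Fin m)) M] [IsManifold (𝓡 m) ∞ M]
    {p q : ℕ} (hp : 0 < p) (hq : 0 < q)
    (g₁ : Bundle.ContMDiffRiemannianMetric (𝓡 n₁) ∞ (EuclideanSpace ℝ (Fin n₁))
      (fun x : M₁ ↦ TangentSpace (𝓡 n₁) x))
    (g₂ : Bundle.ContMDiffRiemannianMetric (𝓡 n₂) ∞ (EuclideanSpace ℝ (Fin n₂))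
      (fun y : M₂ ↦ TangentSpace (𝓡 n₂) y))
    (g : Bundle.ContMDiffRiemannianMetric (𝓡 m) ∞ (EuclideanSpace ℝ (Fin m))
      (fun y : M ↦ TangentSpace (𝓡 m) y))
    (J : (y : M) → TangentSpace (𝓡 m) y →L[ℝ] TangentSpace (𝓡 m) y)
    (hJ : MetallicWarped.IsLocallyMetallicRiemannian p q g J)
    (f : M₁ → ℝ) (i : M₁ × M₂ → M)
    (hi : MetallicWarped.IsWarpedProductSubmanifold g₁ g₂ f g i)
    (h₁ : MetallicWarped.FstAntiInvariant (𝓡 n₁) (𝓡 n₂) g J i)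
    (h₂ : MetallicWarped.SndAntiInvariant (𝓡 n₁) (𝓡 n₂) g J i) :
    (∀ x x' : M₁, x' ∈ connectedComponent x → f x' = f x) ↔
      ∀ (X : (x : M₁) → TangentSpace (𝓡 n₁) x) (Z : (y : M₂) → TangentSpace (𝓡 n₂) y),
        MetallicWarped.IsSmoothVectorField (𝓡 n₁) X →
        MetallicWarped.IsSmoothVectorField (𝓡 n₂) Z →
        ∀ z : M₁ × M₂,
          MetallicWarped.opt ((𝓡 n₁).prod (𝓡 n₂)) g J i z
            (MetallicWarped.normalConnection ((𝓡 n₁).prod (𝓡 n₂)) g i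
              (MetallicWarped.opN ((𝓡 n₁).prod (𝓡 n₂)) g J i
                (MetallicWarped.horizontalLift (𝓡 n₁) (𝓡 n₂) X)) z
              (MetallicWarped.verticalLift (𝓡 n₁) (𝓡 n₂) Z z)) =
          (p : ℝ) • MetallicWarped.opt ((𝓡 n₁).prod (𝓡 n₂)) g J i z
            (MetallicWarped.secondFundamentalForm ((𝓡 n₁).prod (𝓡 n₂)) g i
              (MetallicWarped.horizontalLift (𝓡 n₁) (𝓡 n₂) X)
              (MetallicWarped.verticalLift (𝓡 n₁) (𝓡 n₂) Z) z) := by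
  rw [MetallicWarped.vderiv_eq_zero_iff_const_on_components hi.warping_smooth]
  refine ⟨fun h X Z hX hZ z ↦ ?_, fun h x v ↦ ?_⟩
  · refine (MetallicWarped.opt_normalConnection_eq_iff hq hJ hi h₁ h₂ hX hZ z).2 fun γ ↦ ?_
    rw [h, mul_zero, zero_mul]
  -- A point of `M₂` and `0 < n₂` provide a vertical field `Z` with `Z y ≠ 0`. Testing against the
  -- vertical vector `Z y` gives the positive factor `g₂(Z, Z)`, and `f > 0`, so the derivative of
  -- `f` along `v` must vanish.
  · obtain ⟨y⟩ := ‹Nonempty M₂›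
    have : Nonempty (Fin n₂) := ⟨⟨0, hn₂⟩⟩
    obtain ⟨b, hb⟩ := exists_ne (0 : EuclideanSpace ℝ (Fin n₂))
    obtain ⟨X, hX, rfl⟩ := MetallicWarped.exists_smoothVectorField_apply_eq x v
    obtain ⟨Z, hZ, hZb⟩ := MetallicWarped.exists_smoothVectorField_apply_eq (M := M₂) y b
    have h0 := (MetallicWarped.opt_normalConnection_eq_iff hq hJ hi h₁ h₂ hX hZ (x, y)).1
      (h X Z hX hZ (x, y)) (MetallicWarped.prodVec (x := (x, y)) 0 (Z y))
    have hpos : 0 < g₂.inner y (Z y) (Z y) := g₂.pos y _ (hZb ▸ hb)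
    exact (mul_eq_zero.1 ((mul_eq_zero.1 h0).resolve_right hpos.ne')).resolve_left
      (hi.warping_pos x).ne'
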